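/- Let $n\ge 2$, let $\mathfrak g=\mathfrak{sl}(n,\mathbb C)$ with Killing form $K$, let $\Omega=\sum_i I_i\otimes I^i\in\mathfrak g\otimes\mathfrak g$ be the Casimir element ($(I_i)$, $(I^i)$ dual bases with respect to $K$), and let $P=\mathfrak g[u]$. A *quasi-rational $r$-matrix* is a solution $q$ of the classical Yang–Baxter equation $$[q_{12}(u_1,u_2),q_{13}(u_1,u_3)]+[q_{12}(u_1,u_2),q_{23}(u_2,u_3)]+[q_{13}(u_1,u_3),q_{23}(u_2,u_3)]=0$$ of the form $q(u,v)=\frac{uv\,\Omega}{v-u}+p(u,v)$, where $p\in P\otimes P=(\mathfrak g\otimes\mathfrak g)[u,v]$ is skew-symmetric, i.e. $p_{21}(v,u)=-p(u,v)$. Two quasi-rational $r$-matrices $q_1,q_2$ are *gauge equivalent* if $q_2(u,v)=(\mathrm{Ad}\,\sigma(u)\otimes \mathrm{Ad}\,\sigma(v))\,q_1(u,v)$ for some $\sigma\in SL(n,\mathbb C[u])$. Let $D_4=\mathfrak g((u^{-1}))\oplus\mathfrak g[\varepsilon]$ with $\varepsilon^2=0$, with the form $$Q(f+A_0+A_1\varepsilon,\;g+B_0+B_1\varepsilon)=\mathrm{Res}\,u^{-2}K(f,g)-K(A_0,B_1)-K(A_1,B_0),$$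 where $\mathrm{Res}$ is the coefficient of $u^{-1}$ and $K(f,g)$ is the Killing form of $\mathfrak g((u^{-1}))$ over $\mathbb C((u^{-1}))$. Embed $P$ into $D_4$ by $i\bigl(\sum_k c_ku^k\bigr)=\sum_k c_ku^k+c_0+c_1\varepsilon$. The subspace $W\subset D_4$ that *corresponds* to $q=\frac{uv\,\Omega}{v-u}+p$, $p=\sum_j a_j\otimes b_j$, is $$W=\Bigl\{\,w+\sum_j Q(w,i(a_j))\,i(b_j)\;:\; w\in \mathfrak g[[u^{-1}]]\oplus\mathfrak g\,\varepsilon\Bigr\}.$$ Theorem. For every quasi-rational $r$-matrix $q_1$ there is a quasi-rational $r$-matrix $q_2$, gauge equivalent to $q_1$, such that the corresponding $W_2\subset D_4$ is a Lagrangian Lie subalgebra ($W_2=W_2^{\perp}$ with respect to $Q$) and is contained in $$W_k=d_k^{-1}\,\mathfrak{sl}(n,\mathbb C[[u^{-1}]])\,d_k\;\oplus\;\mathfrak{sl}(n,\mathbb C[\varepsilon])$$ for some $k$ with $0\le k\le n$, where $d_k=\mathrm{diag}(\underbrace{1,\dots,1}_{k},\underbrace{u,\dots,u}_{n-k})$.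 -/

import Mathlib

open scoped TensorProduct
open LieAlgebra.SpecialLinear

noncomputable section

namespace QuasiRational

attribute [local instance] LieRing.ofAssociativeRing

/-! ### Laurent series in `u⁻¹` -/

/-- The field `ℂ((u⁻¹))` of Laurent series in the variable `u⁻¹`. (It is a separate copy of
Mathlib's Laurent series so that its only `ℂ`-module structure is the usual one.) -/
def Laur : Type := LaurentSeries ℂ

instance instFieldLaur : Field Laur := inferInstanceAs (Field (LaurentSeries ℂ))

instance instAlgebraLaur : Algebra ℂ Laur :=
  (HahnSeries.instAlgebra : Algebra ℂ (HahnSeries ℤ ℂ))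

/-- The coefficient of `u ^ m`, i.e. of `(u⁻¹) ^ (-m)`. -/
def coeffU (m : ℤ) : Laur →ₗ[ℂ] ℂ where
  toFun f := HahnSeries.coeff (f : LaurentSeries ℂ) (-m)
  map_add' _ _ := rfl
  map_smul' _ _ := rfl

/-- The element `u` of `ℂ((u⁻¹))`. -/
def uL : Laur := (HahnSeries.single (-1) 1 : LaurentSeries ℂ)

/-- The inclusion `ℂ[[u⁻¹]] → ℂ((u⁻¹))`. -/
def ofPS : PowerSeries ℂ →ₐ[ℂ] Laur :=
  HahnSeries.ofPowerSeriesAlg (A := ℂ) ℤ ℂ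

/-! ### The Lie algebras -/

/-- Coefficientwise application of a `ℂ`-linear map `A → B` to a trace zero matrix. -/
def slMap (n : ℕ) {A B : Type} [CommRing A] [Algebra ℂ A] [CommRing B] [Algebra ℂ B]
    (f : A →ₗ[ℂ] B) : sl (Fin n) A →ₗ[ℂ] sl (Fin n) B where
  toFun x := ⟨x.1.map f, by
    have hx : Matrix.trace x.1 = 0 := x.2
    change Matrix.trace (x.1.map f) = 0
    have h : Matrix.trace (x.1.map f) = f (Matrix.trace x.1) := by
      simp [Matrix.trace, map_sum]
    rw [h, hx, map_zero]⟩
  map_add' x y := Subtype.ext (by ext i j; exact map_add f _ _)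
  map_smul' c x := Subtype.ext (by ext i j; exact map_smul f _ _)

/-- The simple Lie algebra `𝔤 = sl(n, ℂ)`. -/
abbrev 𝔤 (n : ℕ) : Type := sl (Fin n) ℂ

/-- The polynomial Lie algebra `P = 𝔤[u] = sl(n, ℂ[u])`. -/
abbrev P (n : ℕ) : Type := sl (Fin n) (Polynomial ℂ)

/-- The double `D₄(P) = 𝔤((u⁻¹)) ⊕ 𝔤[ε]`. -/
abbrev Double (n : ℕ) : Type := sl (Fin n) Laur × sl (Fin n) (DualNumber ℂ)

instance instLieAlgebraLaur (n : ℕ) : LieAlgebra ℂ (sl (Fin n) Laur) where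
  toModule := inferInstance
  lie_smul c x y := Subtype.ext (by
    change x.1 * (c • y.1) - (c • y.1) * x.1 = c • (x.1 * y.1 - y.1 * x.1)
    rw [Matrix.mul_smul, Matrix.smul_mul, smul_sub])

instance instLieAlgebraDual (n : ℕ) : LieAlgebra ℂ (sl (Fin n) (DualNumber ℂ)) where
  toModule := inferInstance
  lie_smul c x y := Subtype.ext (by
    change x.1 * (c • y.1) - (c • y.1) * x.1 = c • (x.1 * y.1 - y.1 * x.1)
    rw [Matrix.mul_smul, Matrix.smul_mul, smul_sub])

/-- The embedding `i : P → D₄(P)`, `∑ cₖ uᵏ ↦ (∑ cₖ uᵏ, c₀ + c₁ ε)`. -/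
def emb (n : ℕ) : P n →ₗ[ℂ] Double n :=
  (slMap n (Polynomial.aeval (R := ℂ) uL).toLinearMap).prod
    (slMap n (Polynomial.aeval (R := ℂ) (DualNumber.eps : DualNumber ℂ)).toLinearMap)

/-- The part `A₀ ∈ 𝔤` of `A₀ + A₁ ε`. -/
def dualFst (n : ℕ) : sl (Fin n) (DualNumber ℂ) →ₗ[ℂ] 𝔤 n :=
  slMap n (TrivSqZeroExt.fstHom ℂ ℂ ℂ).toLinearMap

/-- The part `A₁ ∈ 𝔤` of `A₀ + A₁ ε`. -/
def dualSnd (n : ℕ) : sl (Fin n) (DualNumber ℂ) →ₗ[ℂ] 𝔤 n :=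
  slMap n (TrivSqZeroExt.sndHom ℂ ℂ)

/-! ### The invariant form on the double -/

/-- The residue: the coefficient of `u⁻¹`. -/
def res : Laur →ₗ[ℂ] ℂ := coeffU (-1)

/-- The Killing form of the Lie algebra `𝔤((u⁻¹))` over the field `ℂ((u⁻¹))`. -/
def killingL (n : ℕ) : LinearMap.BilinForm Laur (sl (Fin n) Laur) :=
  killingForm Laur (sl (Fin n) Laur)

/-- The Killing form of `𝔤` over `ℂ`. -/
def killing (n : ℕ) : LinearMap.BilinForm ℂ (𝔤 n) := killingForm ℂ (𝔤 n)

/-- The form `Q(f + A₀ + A₁ ε, g + B₀ + B₁ ε) = Res u⁻² K(f, g) - K(A₀, B₁) - K(A₁, B₀)`. -/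
def Q (n : ℕ) : LinearMap.BilinForm ℂ (Double n) :=
  LinearMap.mk₂ ℂ
    (fun x y ↦ res (uL⁻¹ ^ 2 * killingL n x.1 y.1)
      - killing n (dualFst n x.2) (dualSnd n y.2) - killing n (dualSnd n x.2) (dualFst n y.2))
    (fun x x' y ↦ by
      simp only [Prod.fst_add, Prod.snd_add, map_add, LinearMap.add_apply, mul_add]; ring)
    (fun c x y ↦ by
      have h : killingL n (c • x.1) y.1 = c • killingL n x.1 y.1 := by
        rw [← algebraMap_smul Laur c x.1, map_smul, LinearMap.smul_apply,
          algebraMap_smul]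
      simp only [Prod.smul_fst, Prod.smul_snd, map_smul, LinearMap.smul_apply, h,
        mul_smul_comm, smul_sub])
    (fun x y y' ↦ by
      simp only [Prod.fst_add, Prod.snd_add, map_add, mul_add]; ring)
    (fun c x y ↦ by
      have h : killingL n x.1 (c • y.1) = c • killingL n x.1 y.1 := by
        rw [← algebraMap_smul Laur c y.1, map_smul, algebraMap_smul]
      simp only [Prod.smul_fst, Prod.smul_snd, map_smul, h, mul_smul_comm, smul_sub])

/-- A subalgebra `W` of the double is Lagrangian if it equals its orthogonal complement. -/
def IsLagrangian {n : ℕ} (W : LieSubalgebra ℂ (Double n)) : Prop :=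
  ∀ x, x ∈ W ↔ ∀ y ∈ W, Q n x y = 0

/-! ### The Casimir element -/

theorem trace_mul_mul {K : Type*} [Field K] (n : ℕ) (a b : Matrix (Fin n) (Fin n) K) :
    LinearMap.trace K _ (LinearMap.mulLeft K a ∘ₗ LinearMap.mulRight K b) =
      a.trace * b.trace := by
  rw [LinearMap.trace_eq_matrix_trace K (Matrix.stdBasis K (Fin n) (Fin n))]
  simp only [Matrix.trace, Matrix.diag, LinearMap.toMatrix_apply, Fintype.sum_prod_type]
  rw [Finset.sum_mul_sum]
  refine Finset.sum_congr rfl fun i _ ↦ Finset.sum_congr rfl fun j _ ↦ ?_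
  have : ∀ (m : Matrix (Fin n) (Fin n) K),
      (Matrix.stdBasis K (Fin n) (Fin n)).repr m (i, j) = m i j := fun m ↦ rfl
  rw [this]
  simp only [Matrix.stdBasis_eq_single, LinearMap.comp_apply, LinearMap.mulLeft_apply,
    LinearMap.mulRight_apply, Matrix.mul_apply, Matrix.single_apply, ite_mul, one_mul, zero_mul]
  rw [Finset.sum_eq_single i]
  · simp
  · intro k _ hk
    simp [Ne.symm hk]
  · simp

/-- On `sl(n)` the Killing form is `2 n tr(x y)`. -/
theorem killingForm_sl {K : Type*} [Field K] (n : ℕ) (x y : sl (Fin n) K) :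
    killingForm K (sl (Fin n) K) x y = 2 * n * Matrix.trace (x.1 * y.1) := by
  have hx : Matrix.trace x.1 = 0 := x.2
  have hy : Matrix.trace y.1 = 0 := y.2
  let L := fun a : Matrix (Fin n) (Fin n) K ↦ LinearMap.mulLeft K a
  let R := fun a : Matrix (Fin n) (Fin n) K ↦ LinearMap.mulRight K a
  let F : Module.End K (Matrix (Fin n) (Fin n) K) := (L x.1 - R x.1) ∘ₗ (L y.1 - R y.1)
  have hF : ∀ z, F z ∈ (sl (Fin n) K).toSubmodule := fun z ↦ by
    change Matrix.trace (x.1 * (y.1 * z - z * y.1) - (y.1 * z - z * y.1) * x.1) = 0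
    rw [Matrix.trace_sub, Matrix.trace_mul_comm, sub_self]
  have h1 : killingForm K (sl (Fin n) K) x y = LinearMap.trace K _ F := by
    rw [killingForm_apply_apply,
      ← LinearMap.trace_restrict_eq_of_forall_mem (sl (Fin n) K).toSubmodule F hF]
    rfl
  have h2 : F = L (x.1 * y.1) ∘ₗ R 1 - L x.1 ∘ₗ R y.1 - L y.1 ∘ₗ R x.1
      + L 1 ∘ₗ R (y.1 * x.1) := by
    refine LinearMap.ext fun z ↦ ?_
    change x.1 * (y.1 * z - z * y.1) - (y.1 * z - z * y.1) * x.1 =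
      x.1 * y.1 * (z * 1) - x.1 * (z * y.1) - y.1 * (z * x.1) + 1 * (z * (y.1 * x.1))
    noncomm_ring
  rw [h1, h2, map_add, map_sub, map_sub, trace_mul_mul, trace_mul_mul, trace_mul_mul,
    trace_mul_mul, hx, hy, Matrix.trace_one, Matrix.trace_mul_comm y.1 x.1, Fintype.card_fin]
  ring

theorem killing_nondegenerate (n : ℕ) : (killing n).Nondegenerate := by
  have hs : LinearMap.IsSymm (killing n) := LieModule.traceForm_isSymm ℂ (𝔤 n) (𝔤 n)
  refine (LinearMap.IsRefl.nondegenerate_iff_separatingLeft hs.isRefl).2 ?_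
  intro x hx
  rcases Nat.eq_zero_or_pos n with rfl | hn
  · exact Subtype.ext (Subsingleton.elim _ _)
  have hn' : (n : ℂ) ≠ 0 := by exact_mod_cast hn.ne'
  have hxt : Matrix.trace x.1 = 0 := x.2
  have key : ∀ z : Matrix (Fin n) (Fin n) ℂ, Matrix.trace (x.1 * z) = 0 := fun z ↦ by
    let y : 𝔤 n := ⟨z - (Matrix.trace z / n) • 1, by
      change Matrix.trace (z - (Matrix.trace z / n) • (1 : Matrix (Fin n) (Fin n) ℂ)) = 0
      rw [Matrix.trace_sub, Matrix.trace_smul, Matrix.trace_one, Fintype.card_fin, smul_eq_mul,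
        div_mul_cancel₀ _ hn', sub_self]⟩
    have h := hx y
    rw [show killing n x y = _ from killingForm_sl n x y] at h
    have h' : Matrix.trace (x.1 * y.1) = 0 := by simpa [hn'] using h
    have : Matrix.trace (x.1 * y.1) = Matrix.trace (x.1 * z) := by
      change Matrix.trace (x.1 * (z - (Matrix.trace z / n) • 1)) = _
      rw [Matrix.mul_sub, Matrix.mul_smul, Matrix.mul_one, Matrix.trace_sub, Matrix.trace_smul,
        hxt, smul_zero, sub_zero]
    rw [← this, h']
  refine Subtype.ext (Matrix.ext fun i j ↦ ?_)
  simpa [Matrix.trace_mul_single] using key (Matrix.single j i 1)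

/-- The Casimir element `Ω = ∑ Iᵢ ⊗ Iⁱ ∈ 𝔤 ⊗ 𝔤`, for a basis of `𝔤` and its dual basis with
respect to the Killing form. -/
def Ω (n : ℕ) : 𝔤 n ⊗[ℂ] 𝔤 n :=
  ∑ i, Module.finBasis ℂ (𝔤 n) i ⊗ₜ[ℂ]
    (killing n).dualBasis (killing_nondegenerate n) (Module.finBasis ℂ (𝔤 n)) i

/-! ### Quasi-rational `r`-matrices -/

/-- The bracket of `𝔤` as a bilinear map. -/
def lieBr (n : ℕ) : 𝔤 n →ₗ[ℂ] 𝔤 n →ₗ[ℂ] 𝔤 n :=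
  LinearMap.mk₂ ℂ (fun x y ↦ ⁅x, y⁆) add_lie smul_lie lie_add lie_smul

/-- `[x₁₂, y₁₃]`: on pure tensors, `[a ⊗ b ⊗ 1, c ⊗ 1 ⊗ d] = [a, c] ⊗ b ⊗ d`. -/
def br₁₂₁₃ {n : ℕ} (x y : 𝔤 n ⊗[ℂ] 𝔤 n) : 𝔤 n ⊗[ℂ] (𝔤 n ⊗[ℂ] 𝔤 n) :=
  TensorProduct.map₂ (lieBr n) (TensorProduct.mk ℂ (𝔤 n) (𝔤 n)) x y

/-- `[x₁₂, y₂₃]`: on pure tensors, `[a ⊗ b ⊗ 1, 1 ⊗ c ⊗ d] = a ⊗ [b, c] ⊗ d`. -/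
def br₁₂₂₃ {n : ℕ} (x y : 𝔤 n ⊗[ℂ] 𝔤 n) : 𝔤 n ⊗[ℂ] (𝔤 n ⊗[ℂ] 𝔤 n) :=
  TensorProduct.assoc ℂ _ _ _ (TensorProduct.rightComm ℂ _ _ _
    (TensorProduct.map₂ (TensorProduct.mk ℂ (𝔤 n) (𝔤 n)) (lieBr n) x
      (TensorProduct.comm ℂ _ _ y)))

/-- `[x₁₃, y₂₃]`: on pure tensors, `[a ⊗ 1 ⊗ b, 1 ⊗ c ⊗ d] = a ⊗ c ⊗ [b, d]`. -/
def br₁₃₂₃ {n : ℕ} (x y : 𝔤 n ⊗[ℂ] 𝔤 n) : 𝔤 n ⊗[ℂ] (𝔤 n ⊗[ℂ] 𝔤 n) :=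
  TensorProduct.assoc ℂ _ _ _
    (TensorProduct.map₂ (TensorProduct.mk ℂ (𝔤 n) (𝔤 n)) (lieBr n) x y)

theorem br₁₂₁₃_tmul {n : ℕ} (a b c d : 𝔤 n) :
    br₁₂₁₃ (a ⊗ₜ b) (c ⊗ₜ d) = ⁅a, c⁆ ⊗ₜ[ℂ] (b ⊗ₜ[ℂ] d) := rfl

theorem br₁₂₂₃_tmul {n : ℕ} (a b c d : 𝔤 n) :
    br₁₂₂₃ (a ⊗ₜ b) (c ⊗ₜ d) = a ⊗ₜ[ℂ] (⁅b, c⁆ ⊗ₜ[ℂ] d) := rfl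

theorem br₁₃₂₃_tmul {n : ℕ} (a b c d : 𝔤 n) :
    br₁₃₂₃ (a ⊗ₜ b) (c ⊗ₜ d) = a ⊗ₜ[ℂ] (c ⊗ₜ[ℂ] ⁅b, d⁆) := rfl

/-- The classical Yang-Baxter equation
`[q₁₂(u₁,u₂), q₁₃(u₁,u₃)] + [q₁₂(u₁,u₂), q₂₃(u₂,u₃)] + [q₁₃(u₁,u₃), q₂₃(u₂,u₃)] = 0`
for a function `q(u, v)` that is defined for `u ≠ v`. -/
def CYBE {n : ℕ} (q : ℂ → ℂ → 𝔤 n ⊗[ℂ] 𝔤 n) : Prop :=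
  ∀ u₁ u₂ u₃ : ℂ, u₁ ≠ u₂ → u₁ ≠ u₃ → u₂ ≠ u₃ →
    br₁₂₁₃ (q u₁ u₂) (q u₁ u₃) + br₁₂₂₃ (q u₁ u₂) (q u₂ u₃) + br₁₃₂₃ (q u₁ u₃) (q u₂ u₃) = 0

/-- Evaluation `P = 𝔤[u] → 𝔤` at the point `c`. -/
def ev (n : ℕ) (c : ℂ) : P n →ₗ[ℂ] 𝔤 n := slMap n (Polynomial.aeval (R := ℂ) c).toLinearMap

/-- The function `(u, v) ↦ u v Ω / (v - u) + p(u, v)`, for a polynomial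
`p ∈ (𝔤 ⊗ 𝔤)[u, v] = 𝔤[u] ⊗ 𝔤[v]`. Only its values at `u ≠ v` are meaningful. -/
def rFun {n : ℕ} (p : P n ⊗[ℂ] P n) (u v : ℂ) : 𝔤 n ⊗[ℂ] 𝔤 n :=
  (u * v / (v - u)) • Ω n + TensorProduct.map (ev n u) (ev n v) p

end QuasiRational

open QuasiRational in
/-- A quasi-rational `r`-matrix `q(u, v) = u v Ω / (v - u) + p(u, v)`: a solution of the classical
Yang-Baxter equation with `p` a skew-symmetric polynomial, `p₂₁(v, u) = -p(u, v)`. -/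
structure QuasiRationalRMatrix (n : ℕ) where
  /-- the polynomial part `p` -/
  poly : P n ⊗[ℂ] P n
  skew : TensorProduct.comm ℂ (P n) (P n) poly = -poly
  cybe : CYBE (rFun poly)

namespace QuasiRational

/-- The `r`-matrix as a function `q(u, v)`, for `u ≠ v`. -/
def _root_.QuasiRationalRMatrix.eval {n : ℕ} (q : QuasiRationalRMatrix n) (u v : ℂ) :
    𝔤 n ⊗[ℂ] 𝔤 n := rFun q.poly u v

/-- The adjoint action `x ↦ g x g⁻¹` of `g ∈ SL(n, ℂ)` on `𝔤 = sl(n, ℂ)`. -/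
def Ad {n : ℕ} (g : Matrix.SpecialLinearGroup (Fin n) ℂ) : 𝔤 n →ₗ[ℂ] 𝔤 n where
  toFun x := ⟨g.1 * x.1 * (g⁻¹).1, by
    have hx : Matrix.trace x.1 = 0 := x.2
    have hg : (g⁻¹).1 * g.1 = 1 := congrArg Subtype.val (inv_mul_cancel g)
    change Matrix.trace (g.1 * x.1 * (g⁻¹).1) = 0
    rw [Matrix.trace_mul_comm, ← Matrix.mul_assoc, hg, Matrix.one_mul, hx]⟩
  map_add' x y := Subtype.ext (by
    change g.1 * (x.1 + y.1) * (g⁻¹).1 = g.1 * x.1 * (g⁻¹).1 + g.1 * y.1 * (g⁻¹).1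
    rw [Matrix.mul_add, Matrix.add_mul])
  map_smul' c x := Subtype.ext (by
    change g.1 * (c • x.1) * (g⁻¹).1 = c • (g.1 * x.1 * (g⁻¹).1)
    rw [Matrix.mul_smul, Matrix.smul_mul])

/-- The value `σ(c) ∈ SL(n, ℂ)` of `σ ∈ SL(n, ℂ[u])` at the point `c`. -/
def evGroup {n : ℕ} (c : ℂ) (σ : Matrix.SpecialLinearGroup (Fin n) (Polynomial ℂ)) :
    Matrix.SpecialLinearGroup (Fin n) ℂ :=
  Matrix.SpecialLinearGroup.map (Polynomial.evalRingHom c) σ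

/-- Gauge equivalence: `q₂(u, v) = (Ad σ(u) ⊗ Ad σ(v)) q₁(u, v)` for an element `Ad σ` of
`Ad 𝔤[u]`, i.e. for a `σ ∈ SL(n, ℂ[u])` acting by conjugation. -/
def GaugeEquivalent {n : ℕ} (q₁ q₂ : QuasiRationalRMatrix n) : Prop :=
  ∃ σ : Matrix.SpecialLinearGroup (Fin n) (Polynomial ℂ), ∀ u v : ℂ, u ≠ v →
    q₂.eval u v = TensorProduct.map (Ad (evGroup u σ)) (Ad (evGroup v σ)) (q₁.eval u v)

/-! ### The Lagrangian subalgebra of a quasi-rational `r`-matrix -/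

/-- The Lagrangian subalgebra `P* = 𝔤[[u⁻¹]] ⊕ 𝔤 ε` of the double, which corresponds to
`u v Ω / (v - u)`. -/
def PStar (n : ℕ) : Set (Double n) :=
  {x | x.1 ∈ Set.range (slMap n ofPS.toLinearMap) ∧
    dualFst n x.2 = 0}

/-- `(Q(w, ·) ⊗ id) p ∈ P ⊆ D₄(P)`: for `p = ∑ aⱼ ⊗ bⱼ` this is `∑ Q(w, aⱼ) bⱼ`. -/
def contract {n : ℕ} (w : Double n) (p : P n ⊗[ℂ] P n) : Double n :=
  TensorProduct.lid ℂ (Double n) (TensorProduct.map (Q n w ∘ₗ emb n) (emb n) p)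

/-- `W` corresponds to `q = u v Ω / (v - u) + p` if `W = {w + (Q(w, ·) ⊗ id) p | w ∈ P*}`.
Let `(eᵢ)` be a basis of `P` and `(fᵢ)`, `(fᵢ')` the dual bases of `P*` and `W` with respect to `Q`.
Then `∑ eᵢ ⊗ fᵢ` projects to `u v Ω / (v - u)` in the first component of the double, and this
says that `fᵢ' = fᵢ + (Q(fᵢ, ·) ⊗ id) p`, i.e. `∑ eᵢ ⊗ fᵢ' = ∑ eᵢ ⊗ fᵢ + p`, which projects
to `q`. -/
def Corresponds {n : ℕ} (W : LieSubalgebra ℂ (Double n)) (q : QuasiRationalRMatrix n) : Prop :=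
  (W : Set (Double n)) = {x | ∃ w ∈ PStar n, x = w + contract w q.poly}

/-- The matrix `d_k = diag(1, …, 1, u, …, u)` with `k` ones. -/
def dMat (n k : ℕ) : Matrix (Fin n) (Fin n) Laur :=
  Matrix.diagonal fun i ↦ if (i : ℕ) < k then 1 else uL

/-- `W_k = d_k⁻¹ sl(n, ℂ[[u⁻¹]]) d_k ⊕ sl(n, ℂ[ε])`. -/
def Wk (n k : ℕ) : Set (Double n) :=
  {x | ∃ y : sl (Fin n) (PowerSeries ℂ),
    x.1.1 = (dMat n k)⁻¹ * y.1.map ofPS * dMat n k}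

end QuasiRational

end

/-! ### Associative algebras generated by Lie algebras of integral elements -/

section IntegralMatrices

variable {O A : Type*} [CommRing O] [Ring A] [Algebra O A]

/-! Lagrangian subalgebra. `P` and `P*` are isotropic for `Q` and together span the double. Skewness
of `p` keeps W = {w + (Q(w, ·) ⊗ id) p} isotropic, and W still spans the double together with `P`,
so W is Lagrangian (`mem_graphSub_iff`). The Yang–Baxter equation makes W a Lie algebra. Expand c u
z/(u - c) at u = ∞ and, to first order, at u = 0 (`testElt`). The associated element of W is the
same expansion of (K(z, ·) ⊗ id) q(c, u), and contracting the equation at (c, d, u) with z and w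
writes the bracket of two such elements as minus a sum of two more (`lie_graphMap_testElt`). By a
Vandermonde argument these elements exhaust `P*` up to terms of very negative degree, which `Q`
cannot detect on elements of bounded degree.

Maximal order. Put O = ℂ[[u⁻¹]] and F = ℂ((u⁻¹)), and project W to sl(n, F). The image is a Lie
algebra of bounded degree, contains every trace zero matrix of sufficiently negative degree, and
together with 𝔤[u] spans sl(n, F). Its O-span is a finitely generated Lie algebra, so each ad x is
integral over O. As x has trace zero and n is invertible, x itself is integral
(`isIntegral_of_adMat`). A finitely generated Lie algebra of integral elements generates a finite
associative algebra (`exists_fg_stable_of_isIntegral`), hence stabilizes a lattice in Fⁿ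
(`exists_conj_integral`).

Normal form. By a Birkhoff–Grothendieck factorization (`exists_specialLinear_factorization`) some
element of SL(n, ℂ[u]) moves this lattice to ⊕ u^(-mᵢ) O, so that after conjugation the (i, j)
entries have degree at most mⱼ - mᵢ. Since W and 𝔤[u] span, the matrices u⁻¹Eᵢⱼ must be reached,
which forces |mᵢ - mⱼ| ≤ 1. With m sorted this is the order given by some d_k
(`exists_conj_mem_bd`).

Gauge transformation. Conjugation by SL(n, ℂ[u]) changes u v Ω/(v - u) only by a polynomial, because
Ω is invariant. So it acts on r-matrices, and it conjugates the first components of the test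
elements of W (`graphMap_testElt_gauge`). `Wk` puts no condition on the component in sl(n, ℂ[ε]), so
this is enough. -/

theorem list_prod_mem_pow_of_subset (T : Submodule O A) (l : List A) (h : ∀ x ∈ l, x ∈ T) :
    l.prod ∈ T ^ l.length := by
  induction l with
  | nil => exact Submodule.one_le.1 le_rfl
  | cons x l ih =>
    rw [List.prod_cons, List.length_cons, pow_succ']
    exact Submodule.mul_mem_mul (h x (by simp)) (ih fun y hy ↦ h y (by simp [hy]))

theorem Submodule.pow_mono_of_one_le {T : Submodule O A} (h1 : 1 ≤ T) {k m : ℕ} (h : k ≤ m) :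
    T ^ k ≤ T ^ m := pow_le_pow_right₀ h1 h

/-- Reordering a product of elements of a Lie subalgebra changes it by lower order terms. -/
theorem List.Perm.prod_sub_prod_mem_pow {T : Submodule O A}
    (hlie : ∀ x ∈ T, ∀ y ∈ T, x * y - y * x ∈ T) {l l' : List A} (hp : l.Perm l')
    (h : ∀ x ∈ l, x ∈ T) : l.prod - l'.prod ∈ T ^ (l.length - 1) := by
  induction hp with
  | nil => simp
  | @cons x l l' hp ih =>
    have := ih fun y hy ↦ h y (by simp [hy])
    rcases l with _ | ⟨a, l⟩
    · simp [List.nil_perm.1 hp]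
    · rw [List.prod_cons, List.prod_cons (l := l'), ← mul_sub]
      have h2 := Submodule.mul_mem_mul (h x (by simp)) this
      rw [← pow_succ'] at h2
      simpa using h2
  | swap x y l =>
    have h2 := Submodule.mul_mem_mul (hlie y (h y (by simp)) x (h x (by simp)))
      (list_prod_mem_pow_of_subset T l fun z hz ↦ h z (by simp [hz]))
    rw [← pow_succ'] at h2
    simpa [mul_assoc, sub_mul] using h2
  | @trans l₁ l₂ l₃ hp hp' ih ih' =>
    have h2 := ih' fun x hx ↦ h x (hp.mem_iff.2 hx)
    rw [← hp.length_eq] at h2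
    simpa using add_mem (ih h) h2

/-- An integral equation of x lowers the filtration degree of every high power of x by one. This is
what bounds the length of the words that are needed to span the generated algebra. -/
theorem pow_mem_span_pow_lt {x : A} {T : Submodule O A} (h1 : 1 ≤ T) (hx : x ∈ T)
    (hi : IsIntegral O x) : ∃ d : ℕ, 0 < d ∧ ∀ e, d ≤ e → x ^ e ∈ T ^ (e - 1) := by
  obtain ⟨p, hp, hp0⟩ := hi
  have hpow : ∀ j, x ^ j ∈ T ^ j := fun j ↦ Submodule.pow_mem_pow _ hx j
  -- The equation is multiplied by x once more, so that the bound is positive and the truncated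
  -- subtraction causes no trouble when the degree is zero.
  have key : x ^ (p.natDegree + 1) ∈ T ^ p.natDegree := by
    have h2 : x ^ (p.natDegree + 1) =
        -∑ i ∈ Finset.range p.natDegree, p.coeff i • x ^ (i + 1) := by
      have h3 : Polynomial.aeval x p = 0 := hp0
      rw [Polynomial.aeval_eq_sum_range, Finset.sum_range_succ, hp.coeff_natDegree, one_smul] at h3
      have h4 := congrArg (· * x) h3
      simp only [add_mul, zero_mul, Finset.sum_mul, smul_mul_assoc, ← pow_succ] at h4
      exact eq_neg_of_add_eq_zero_right h4
    rw [h2]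
    refine neg_mem (sum_mem fun i hi ↦ Submodule.smul_mem _ _ ?_)
    exact Submodule.pow_mono_of_one_le h1 (Finset.mem_range.1 hi) (hpow _)
  refine ⟨p.natDegree + 1, Nat.succ_pos _, fun e he ↦ ?_⟩
  obtain ⟨k, rfl⟩ := Nat.exists_eq_add_of_le he
  have h5 := Submodule.mul_mem_mul key (hpow k)
  rw [← pow_add, ← pow_add] at h5
  have : p.natDegree + 1 + k - 1 = p.natDegree + k := by omega
  rwa [this]

/-- The associative algebra generated by a finitely generated Lie algebra of integral elements
is a finitely generated module. -/
theorem exists_fg_stable_of_isIntegral (s : Finset A)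
    (hlie : ∀ x ∈ Submodule.span O (s : Set A), ∀ y ∈ Submodule.span O (s : Set A),
      x * y - y * x ∈ Submodule.span O (s : Set A))
    (hint : ∀ x ∈ s, IsIntegral O x) :
    ∃ B : Submodule O A, B.FG ∧ 1 ∈ B ∧ ∀ x ∈ s, ∀ b ∈ B, x * b ∈ B := by
  classical
  set T : Submodule O A := Submodule.span O (insert 1 (s : Set A)) with hT
  have hTs : T = Submodule.span O {1} ⊔ Submodule.span O (s : Set A) := Submodule.span_insert _ _
  have h1T : (1 : A) ∈ T := Submodule.subset_span (by simp)
  have h1 : 1 ≤ T := Submodule.one_le.2 h1T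
  have hsT : ∀ x ∈ s, x ∈ T := fun x hx ↦ Submodule.subset_span (by simp [hx])
  have hTlie : ∀ x ∈ T, ∀ y ∈ T, x * y - y * x ∈ T := by
    intro x hx y hy
    rw [hTs] at hx hy
    obtain ⟨a, ha, x', hx', rfl⟩ := Submodule.mem_sup.1 hx
    obtain ⟨b, hb, y', hy', rfl⟩ := Submodule.mem_sup.1 hy
    obtain ⟨a, rfl⟩ := Submodule.mem_span_singleton.1 ha
    obtain ⟨b, rfl⟩ := Submodule.mem_span_singleton.1 hb
    have h2 : (a • 1 + x') * (b • 1 + y') - (b • 1 + y') * (a • 1 + x') = x' * y' - y' * x' := by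
      simp only [add_mul, mul_add, smul_mul_assoc, mul_smul_comm, one_mul, mul_one,
        smul_add]
      rw [smul_comm a b]
      abel
    rw [h2, hTs]
    exact Submodule.mem_sup_right (hlie _ hx' _ hy')
  have hTfg : T.FG := ⟨insert 1 s, by simp [hT]⟩
  -- Because 1 lies in T, shorter words are included in higher powers.
  have hpow : ∀ k, T ^ k =
      Submodule.span O {y | ∃ l : List A, (∀ x ∈ l, x ∈ s) ∧ l.length ≤ k ∧ y = l.prod} := by
    intro k
    apply le_antisymm
    · induction k with
      | zero =>
        rw [pow_zero, Submodule.one_eq_span]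
        exact Submodule.span_mono (by
          rintro _ rfl
          exact ⟨[], by simp, by simp, by simp⟩)
      | succ k ih =>
        rw [pow_succ']
        refine (mul_le_mul' le_rfl ih).trans ?_
        rw [hT, Submodule.span_mul_span]
        refine Submodule.span_mono ?_
        rintro _ ⟨x, hx, _, ⟨l, hl, hlk, rfl⟩, rfl⟩
        rcases hx with rfl | hx
        · exact ⟨l, hl, by omega, by simp⟩
        · exact ⟨x :: l, by simpa using ⟨hx, hl⟩, by simpa using hlk, by simp⟩
    · refine Submodule.span_le.2 ?_
      rintro _ ⟨l, hl, hlk, rfl⟩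
      exact Submodule.pow_mono_of_one_le h1 hlk
        (list_prod_mem_pow_of_subset T l fun x hx ↦ hsT x (hl x hx))
  choose! d hd0 hd using fun x (hx : x ∈ s) ↦ pow_mem_span_pow_lt h1 (hsT x hx) (hint x hx)
  set M := ∑ x ∈ s, d x with hM
  -- Pigeonhole: in a word of length M + 1 some letter x occurs at least d x times. Collecting its
  -- copies at the front costs only terms of lower length, and then the power of x drops by one.
  -- Hence T ^ (M + 1) = T ^ M, which is the required finite module.
  have hlist : ∀ l : List A, (∀ x ∈ l, x ∈ s) → l.length = M + 1 → l.prod ∈ T ^ M := by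
    intro l hl hlen
    obtain ⟨x, hx, hcount⟩ : ∃ x ∈ s, d x ≤ l.count x := by
      by_contra! hcon
      have h3 : l.length ≤ ∑ x ∈ s, l.count x := by
        have := Multiset.sum_count_eq_card (s := s) (m := (l : Multiset A)) (by simpa using hl)
        simp only [Multiset.coe_count, Multiset.coe_card] at this
        exact this.ge
      have h4 : ∑ x ∈ s, l.count x ≤ M := Finset.sum_le_sum fun x hx ↦ (hcon x hx).le
      omega
    have hperm : l.Perm (List.replicate (l.count x) x ++ l.filter (fun y ↦ ¬ (y == x))) := by
      have h5 := (List.filter_append_perm (fun y ↦ y == x) l).symm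
      rw [List.filter_beq] at h5
      simpa only [Bool.not_eq_true, Bool.decide_eq_false] using h5
    have h6 := hperm.prod_sub_prod_mem_pow hTlie fun y hy ↦ hsT y (hl y hy)
    have h7 : (List.replicate (l.count x) x ++ l.filter (fun y ↦ ¬ (y == x))).prod ∈
        T ^ (l.length - 1) := by
      rw [List.prod_append, List.prod_replicate]
      have h8 := Submodule.mul_mem_mul (hd x hx _ hcount)
        (list_prod_mem_pow_of_subset T (l.filter (fun y ↦ ¬ (y == x)))
          fun y hy ↦ hsT y (hl y (List.mem_filter.1 hy).1))
      rw [← pow_add] at h8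
      have h9 := hperm.length_eq
      rw [List.length_append, List.length_replicate] at h9
      have h10 := hd0 x hx
      have h11 : l.count x - 1 + (l.filter (fun y ↦ ¬ (y == x))).length = l.length - 1 := by
        omega
      rwa [h11] at h8
    have := add_mem h6 h7
    rw [hlen] at this
    simpa using this
  have hstab : T ^ (M + 1) ≤ T ^ M := by
    rw [hpow (M + 1)]
    refine Submodule.span_le.2 ?_
    rintro _ ⟨l, hl, hlk, rfl⟩
    rcases hlk.lt_or_eq with h | h
    · exact Submodule.pow_mono_of_one_le h1 (Nat.lt_succ_iff.1 h)
        (list_prod_mem_pow_of_subset T l fun x hx ↦ hsT x (hl x hx))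
    · exact hlist l hl h
  refine ⟨T ^ M, hTfg.pow M, Submodule.one_le.1 (one_le_pow₀ h1), fun x hx b hb ↦ hstab ?_⟩
  rw [pow_succ']
  exact Submodule.mul_mem_mul (hsT x hx) hb

end IntegralMatrices

/-! ### From integrality of the adjoint action to a stable lattice -/

section IntegralMatrices

open Matrix

variable {O F : Type*} [CommRing O] [Field F] [Algebra O F] {n : ℕ}

/-- The operator `ad x` on matrices. -/
def adMat (K : Type*) [CommRing K] (x : Matrix (Fin n) (Fin n) K) :
    Module.End K (Matrix (Fin n) (Fin n) K) :=
  LinearMap.mulLeft K x - LinearMap.mulRight K x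

theorem adMat_apply {K : Type*} [CommRing K] (x y : Matrix (Fin n) (Fin n) K) :
    adMat K x y = x * y - y * x := rfl

theorem adMat_aeval_map {K : Type*} [Field K] [Algebra O K] [Algebra F K] [IsScalarTower O F K]
    (x : Matrix (Fin n) (Fin n) F) (f : Polynomial O) (y : Matrix (Fin n) (Fin n) F) :
    Polynomial.aeval (adMat K (x.map (algebraMap F K))) f (y.map (algebraMap F K)) =
      (Polynomial.aeval (adMat F x) f y).map (algebraMap F K) := by
  have hpow : ∀ k : ℕ, (adMat K (x.map (algebraMap F K)) ^ k) (y.map (algebraMap F K)) =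
      ((adMat F x ^ k) y).map (algebraMap F K) := by
    intro k
    induction k with
    | zero => simp
    | succ k ih =>
      rw [pow_succ', pow_succ', Module.End.mul_apply, Module.End.mul_apply, ih, adMat_apply,
        adMat_apply, Matrix.map_sub _ (map_sub _), Matrix.map_mul, Matrix.map_mul]
  rw [Polynomial.aeval_eq_sum_range, Polynomial.aeval_eq_sum_range, LinearMap.sum_apply,
    LinearMap.sum_apply]
  ext i j
  simp only [LinearMap.smul_apply, hpow, Matrix.sum_apply, Matrix.smul_apply, Matrix.map_apply,
    map_sum]
  refine Finset.sum_congr rfl fun k _ ↦ ?_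
  rw [Algebra.smul_def, Algebra.smul_def, map_mul, ← IsScalarTower.algebraMap_apply]

/-- A relation for ad x can be tested on matrix units, which are already defined over F. -/
theorem adMat_aeval_eq_zero {K : Type*} [Field K] [Algebra O K] [Algebra F K]
    [IsScalarTower O F K] (x : Matrix (Fin n) (Fin n) F) (f : Polynomial O)
    (hf : Polynomial.aeval (adMat F x) f = 0) :
    Polynomial.aeval (adMat K (x.map (algebraMap F K))) f = 0 := by
  refine LinearMap.ext fun y ↦ ?_
  rw [Matrix.matrix_eq_sum_single y, map_sum]
  refine Finset.sum_eq_zero fun i _ ↦ ?_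
  rw [map_sum]
  refine Finset.sum_eq_zero fun j _ ↦ ?_
  have h1 : Matrix.single i j (y i j) =
      y i j • (Matrix.single i j (1 : F)).map (algebraMap F K) := by
    ext a b
    simp [Matrix.single_apply]
  rw [h1, map_smul, adMat_aeval_map, hf]
  ext; simp

/-- If v is a right eigenvector of x for a and w a left eigenvector for b, the rank one matrix v wᵀ
is an eigenvector of ad x with eigenvalue a - b. So a - b is a root of f. -/
theorem isIntegral_sub_of_mem_roots {K : Type*} [Field K] [Algebra O K]
    (x : Matrix (Fin n) (Fin n) K) {f : Polynomial O} (hm : f.Monic)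
    (hf : Polynomial.aeval (adMat K x) f = 0) {a b : K} (ha : a ∈ x.charpoly.roots)
    (hb : b ∈ x.charpoly.roots) : IsIntegral O (a - b) := by
  have key : ∀ c ∈ x.charpoly.roots, (Matrix.scalar (Fin n) c - x).det = 0 := fun c hc ↦ by
    have := (Polynomial.mem_roots'.1 hc).2
    rwa [Polynomial.IsRoot, Matrix.eval_charpoly] at this
  obtain ⟨v, hv0, hv⟩ := Matrix.exists_mulVec_eq_zero_iff.2 (key a ha)
  obtain ⟨w, hw0, hw⟩ := Matrix.exists_vecMul_eq_zero_iff.2 (key b hb)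
  have hv' : x *ᵥ v = a • v := by
    rw [Matrix.sub_mulVec, sub_eq_zero] at hv
    rw [← hv]
    ext i; simp [Matrix.scalar_apply, Matrix.mulVec_diagonal]
  have hw' : w ᵥ* x = b • w := by
    rw [Matrix.vecMul_sub, sub_eq_zero] at hw
    rw [← hw]
    ext i; simp [Matrix.scalar_apply, Matrix.vecMul_diagonal, mul_comm]
  set m := Matrix.vecMulVec v w with hmdef
  have hm0 : m ≠ 0 := by
    obtain ⟨i, hi⟩ := Function.ne_iff.1 hv0
    obtain ⟨j, hj⟩ := Function.ne_iff.1 hw0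
    intro h
    have := congrFun (congrFun h i) j
    simp only [hmdef, Matrix.vecMulVec_apply, Matrix.zero_apply, mul_eq_zero] at this
    exact this.elim hi hj
  have had : adMat K x m = (a - b) • m := by
    rw [adMat_apply, hmdef, Matrix.mul_vecMulVec, Matrix.vecMulVec_mul, hv', hw',
      Matrix.smul_vecMulVec, Matrix.vecMulVec_smul, sub_smul]
  have hpow : ∀ k : ℕ, (adMat K x ^ k) m = (a - b) ^ k • m := by
    intro k
    induction k with
    | zero => simp
    | succ k ih => rw [pow_succ', Module.End.mul_apply, ih, map_smul, had, smul_smul, pow_succ]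
  have h2 : Polynomial.aeval (a - b) f • m = 0 := by
    have h3 := congrArg (· m) hf
    simp only [LinearMap.zero_apply] at h3
    rw [← h3, Polynomial.aeval_eq_sum_range, Polynomial.aeval_eq_sum_range, LinearMap.sum_apply,
      Finset.sum_smul]
    refine Finset.sum_congr rfl fun k _ ↦ ?_
    rw [LinearMap.smul_apply, hpow, smul_assoc]
  exact ⟨f, hm, (smul_eq_zero.1 h2).resolve_right hm0⟩

/-- A trace zero matrix is integral if its adjoint action is. -/
theorem isIntegral_of_adMat [IsDomain O] [IsIntegrallyClosed O] [IsFractionRing O F]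
    (hn : IsUnit (n : O)) (x : Matrix (Fin n) (Fin n) F) (htr : x.trace = 0)
    {f : Polynomial O} (hm : f.Monic) (hf : Polynomial.aeval (adMat F x) f = 0) :
    IsIntegral O x := by
  let K := AlgebraicClosure F
  set x' : Matrix (Fin n) (Fin n) K := x.map (algebraMap F K) with hx'
  have hf' : Polynomial.aeval (adMat K x') f = 0 := adMat_aeval_eq_zero x f hf
  have hcp : x'.charpoly = x.charpoly.map (algebraMap F K) := Matrix.charpoly_map x _
  have hsum : x'.charpoly.roots.sum = 0 := by
    rw [← Matrix.trace_eq_sum_roots_charpoly_of_splits (IsAlgClosed.splits _)]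
    have := (AddMonoidHom.map_trace (algebraMap F K).toAddMonoidHom x).symm
    simpa [htr] using this
  have hcard : x'.charpoly.roots.card = n := by
    rw [← (IsAlgClosed.splits x'.charpoly).natDegree_eq_card_roots,
      Matrix.charpoly_natDegree_eq_dim, Fintype.card_fin]
  -- The eigenvalues b sum to the trace, which is zero. So n a is the sum of the integral elements a
  -- - b over all b, and n is a unit.
  have hroot : ∀ a ∈ x'.charpoly.roots, IsIntegral O a := by
    intro a ha
    have h1 : IsIntegral O ((x'.charpoly.roots.map fun b ↦ a - b).sum) := by
      refine IsIntegral.multiset_sum fun c hc ↦ ?_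
      obtain ⟨b, hb, rfl⟩ := Multiset.mem_map.1 hc
      exact isIntegral_sub_of_mem_roots x' hm hf' ha hb
    rw [Multiset.sum_map_sub, Multiset.map_const', Multiset.sum_replicate, hcard,
      Multiset.map_id', hsum, sub_zero] at h1
    obtain ⟨r, hr⟩ := hn.exists_left_inv
    have h2 : a = algebraMap O K r * (n • a) := by
      rw [nsmul_eq_mul, ← mul_assoc, ← map_natCast (algebraMap O K), ← map_mul, hr, map_one,
        one_mul]
    rw [h2]
    exact isIntegral_algebraMap.mul h1
  -- The coefficients of the characteristic polynomial are integral and lie in F, hence come from O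
  -- by integral closedness. Cayley–Hamilton then gives an integral equation for x.
  have hcoeff : ∀ i, IsIntegral O (x.charpoly.coeff i) := by
    intro i
    have h1 : IsIntegral O (x'.charpoly.coeff i) := by
      refine Polynomial.isIntegral_coeff_of_factors _ ?_ (IsAlgClosed.splits _) (fun a ha ↦ ?_) i
      · rw [(Matrix.charpoly_monic x').leadingCoeff]
        exact isIntegral_one
      · exact hroot a ((Polynomial.mem_roots (Matrix.charpoly_monic x').ne_zero).2 ha)
    rw [hcp, Polynomial.coeff_map] at h1
    exact (isIntegral_algebraMap_iff (algebraMap F K).injective).1 h1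
  have hlift : x.charpoly ∈ Polynomial.lifts (algebraMap O F) := by
    rw [Polynomial.lifts_iff_coeff_lifts]
    exact fun i ↦ IsIntegrallyClosed.isIntegral_iff.1 (hcoeff i)
  obtain ⟨q, hq, -, hqm⟩ := Polynomial.lifts_and_natDegree_eq_and_monic hlift
    (Matrix.charpoly_monic x)
  refine ⟨q, hqm, ?_⟩
  have h3 := Matrix.aeval_self_charpoly x
  rw [← hq, Polynomial.aeval_map_algebraMap] at h3
  exact h3

/-- A finitely generated Lie algebra of trace zero matrices over the fraction field that together
with the scalars spans all matrices stabilizes a lattice. -/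
theorem exists_conj_integral [IsDomain O] [IsPrincipalIdealRing O] [IsFractionRing O F]
    (hn : IsUnit (n : O)) (L : Submodule O (Matrix (Fin n) (Fin n) F)) (hfg : L.FG)
    (hlie : ∀ x ∈ L, ∀ y ∈ L, x * y - y * x ∈ L) (htr : ∀ x ∈ L, x.trace = 0)
    (hspan : ∀ y : Matrix (Fin n) (Fin n) F, y ∈ Submodule.span F (insert 1 (L : Set _))) :
    ∃ g : Matrix (Fin n) (Fin n) F, g.det ≠ 0 ∧
      ∀ x ∈ L, ∃ y : Matrix (Fin n) (Fin n) O, x * g = g * y.map (algebraMap O F) := by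
  have hint : ∀ x ∈ L, IsIntegral O x := by
    intro x hx
    let A : Module.End O L :=
      ((adMat F x).restrictScalars O).restrict fun y hy ↦ hlie x hx y hy
    have : Module.Finite O L := Module.Finite.iff_fg.2 hfg
    obtain ⟨f, hm, hf⟩ := (Algebra.IsIntegral.isIntegral A : IsIntegral O A)
    have hA : ∀ k : ℕ, ∀ y : L, ((A ^ k) y : Matrix (Fin n) (Fin n) F) = (adMat F x ^ k) y := by
      intro k
      induction k with
      | zero => simp
      | succ k ih =>
        intro y
        rw [pow_succ', pow_succ', Module.End.mul_apply, Module.End.mul_apply, ← ih]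
        rfl
    have hfA : Polynomial.aeval A f = 0 := hf
    have hL : ∀ y ∈ L, Polynomial.aeval (adMat F x) f y = 0 := by
      intro y hy
      have h1 := congrArg (fun B : Module.End O L ↦ ((B ⟨y, hy⟩ : L) : Matrix (Fin n) (Fin n) F)) hfA
      simp only [LinearMap.zero_apply, ZeroMemClass.coe_zero] at h1
      rw [← h1, Polynomial.aeval_eq_sum_range, Polynomial.aeval_eq_sum_range,
        LinearMap.sum_apply, LinearMap.sum_apply, AddSubmonoidClass.coe_finsetSum]
      refine Finset.sum_congr rfl fun k _ ↦ ?_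
      rw [LinearMap.smul_apply, LinearMap.smul_apply, Submodule.coe_smul, hA]
    -- The relation f(ad x) = 0 holds on L only. The extra factor ad x kills the identity and maps L
    -- to itself, and 1 and L span all matrices over F.
    have h0 : Polynomial.aeval (adMat F x) (f * Polynomial.X) = 0 := by
      refine LinearMap.ext fun y ↦ ?_
      rw [map_mul, Polynomial.aeval_X, Module.End.mul_apply, LinearMap.zero_apply]
      have hy := hspan y
      induction hy using Submodule.span_induction with
      | mem z hz =>
        rcases hz with rfl | hz
        · simp [adMat_apply]
        · exact hL _ (hlie x hx z hz)
      | zero => simp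
      | add a b _ _ ha hb => rw [map_add, map_add, ha, hb, add_zero]
      | smul c a _ ha => rw [map_smul, map_smul, ha, smul_zero]
    exact isIntegral_of_adMat hn x (htr x hx) (hm.mul Polynomial.monic_X) h0
  obtain ⟨s, rfl⟩ := hfg
  obtain ⟨B, hBfg, hB1, hB⟩ := exists_fg_stable_of_isIntegral s hlie
    fun x hx ↦ hint x (Submodule.subset_span hx)
  let mv : Matrix (Fin n) (Fin n) F →ₗ[O] (Fin n → F) →ₗ[O] (Fin n → F) :=
    LinearMap.mk₂ O (fun a v ↦ a *ᵥ v) Matrix.add_mulVec Matrix.smul_mulVec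
      Matrix.mulVec_add (fun c a v ↦ Matrix.mulVec_smul a c v)
  let E : Submodule O (Fin n → F) := Submodule.span O (Set.range fun i ↦ Pi.single i (1 : F))
  -- The lattice B·Oⁿ is finitely generated, contains Oⁿ because 1 ∈ B, and is stable because x B ⊆
  -- B for the generators x of L.
  let Λ : Submodule O (Fin n → F) := Submodule.map₂ mv B E
  have hEΛ : E ≤ Λ := fun v hv ↦ by
    have := Submodule.apply_mem_map₂ mv hB1 hv
    simpa [mv] using this
  have hΛ : ∀ x ∈ Submodule.span O (s : Set (Matrix (Fin n) (Fin n) F)), ∀ v ∈ Λ,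
      x *ᵥ v ∈ Λ := by
    intro x hx v hv
    induction hx using Submodule.span_induction with
    | mem x hx =>
      have h1 : Λ ≤ Λ.comap (mv x) := Submodule.map₂_le.2 fun b hb e he ↦ by
        change x *ᵥ (b *ᵥ e) ∈ Λ
        rw [Matrix.mulVec_mulVec]
        exact Submodule.apply_mem_map₂ mv (hB x hx b hb) he
      exact h1 hv
    | zero => simp
    | add a b _ _ ha hb => rw [Matrix.add_mulVec]; exact add_mem ha hb
    | smul c a _ ha => rw [Matrix.smul_mulVec]; exact Submodule.smul_mem _ _ ha
  have hlat : Submodule.IsLattice F Λ :=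
    { fg := hBfg.map₂ mv (Submodule.fg_span (Set.finite_range _))
      span_eq_top := by
        refine eq_top_iff.2 fun v _ ↦ ?_
        rw [pi_eq_sum_univ' v]
        refine sum_mem fun i _ ↦ Submodule.smul_mem _ _ (Submodule.subset_span (hEΛ ?_))
        exact Submodule.subset_span ⟨i, by ext j; simp [Pi.single_apply, eq_comm]⟩ }
  have : Module.Finite O Λ := Submodule.IsLattice.finite F Λ
  have : Module.Free O Λ := Submodule.IsLattice.free F Λ
  let b₀ := Module.finBasis O Λ
  have hrank : Module.finrank O Λ = n := by
    rw [Submodule.IsLattice.finrank_of_pi F Λ, Fintype.card_fin]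
  let b : Module.Basis (Fin n) O Λ := b₀.reindex (finCongr hrank)
  let b' := b.extendOfIsLattice F
  -- The columns of g are an O-basis of Λ, and y is the matrix of x in this basis.
  refine ⟨Matrix.of fun i j ↦ (b j : Fin n → F) i, ?_, fun x hx ↦
    ⟨Matrix.of fun i j ↦ b.repr ⟨x *ᵥ b j, hΛ x hx _ (b j).2⟩ i, ?_⟩⟩
  · have h1 : (Matrix.of fun i j ↦ (b j : Fin n → F) i) =
        (Pi.basisFun F (Fin n)).toMatrix b' := by
      ext i j
      simp [Module.Basis.toMatrix_apply, b']
    rw [h1]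
    have := (Pi.basisFun F (Fin n)).invertibleToMatrix b'
    exact (Matrix.isUnit_det_of_invertible _).ne_zero
  · ext i j
    have h1 := congrArg (fun v : Λ ↦ (v : Fin n → F) i)
      (b.sum_repr ⟨x *ᵥ b j, hΛ x hx _ (b j).2⟩)
    simp only [AddSubmonoidClass.coe_finsetSum, Submodule.coe_smul, Finset.sum_apply,
      Pi.smul_apply] at h1
    rw [Matrix.mul_apply, Matrix.mul_apply]
    simp only [Matrix.of_apply, Matrix.map_apply]
    simp only [Matrix.mulVec, dotProduct] at h1
    rw [← h1]
    refine Finset.sum_congr rfl fun k _ ↦ ?_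
    rw [Algebra.smul_def, mul_comm]

end IntegralMatrices

noncomputable section

namespace QuasiRational

attribute [local instance] LieRing.ofAssociativeRing

/-! ### Laurent series of bounded degree -/

instance instAlgebraPowerSeriesLaur : Algebra (PowerSeries ℂ) Laur := ofPS.toRingHom.toAlgebra

instance instIsFractionRingLaur : IsFractionRing (PowerSeries ℂ) Laur :=
  inferInstanceAs (IsFractionRing (PowerSeries ℂ) (LaurentSeries ℂ))

theorem ofPS_injective : Function.Injective ofPS := IsFractionRing.injective (PowerSeries ℂ) Laur

theorem uL_ne_zero : uL ≠ 0 := by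
  intro h
  exact (one_ne_zero (α := ℂ)) (HahnSeries.single_eq_zero_iff.1 h)

theorem uL_zpow (m : ℤ) : uL ^ m = (HahnSeries.single (-m) 1 : LaurentSeries ℂ) := by
  have h := RatFunc.single_zpow (F := ℂ) (-m)
  rw [h, zpow_neg, ← inv_zpow]
  congr 1
  refine eq_inv_of_mul_eq_one_left ?_
  have h1 : (HahnSeries.single (-1) 1 : HahnSeries ℤ ℂ) * HahnSeries.single 1 1 = 1 := by
    rw [HahnSeries.single_mul_single]
    simp
  exact h1

theorem ofPS_X : ofPS PowerSeries.X = uL⁻¹ := by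
  rw [← zpow_neg_one, uL_zpow, neg_neg]
  exact HahnSeries.ofPowerSeries_X

theorem coeffU_uL_zpow_mul_ofPS (k m : ℤ) (g : PowerSeries ℂ) :
    coeffU k (uL ^ m * ofPS g) = if k ≤ m then PowerSeries.coeff (m - k).toNat g else 0 := by
  rw [uL_zpow]
  change HahnSeries.coeff (HahnSeries.single (-m) 1 * HahnSeries.ofPowerSeries ℤ ℂ g) (-k) = _
  rw [HahnSeries.coeff_single_mul, one_mul, PowerSeries.coeff_coe]
  have : -k - -m = m - k := by ring
  rw [this]
  by_cases h : k ≤ m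
  · rw [if_pos h, if_neg (by omega)]
    congr 2
    omega
  · rw [if_neg h, if_pos (by omega)]

/-- Laurent series of degree at most `m` in `u`, i.e. `u ^ m ℂ[[u⁻¹]]`. -/
def bd (m : ℤ) : Submodule ℂ Laur where
  carrier := {f | ∃ g, f = uL ^ m * ofPS g}
  add_mem' := by
    rintro _ _ ⟨g, rfl⟩ ⟨h, rfl⟩
    exact ⟨g + h, by rw [map_add, mul_add]⟩
  zero_mem' := ⟨0, by simp⟩
  smul_mem' := by
    rintro c _ ⟨g, rfl⟩
    exact ⟨c • g, by rw [map_smul, mul_smul_comm]⟩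

theorem mem_bd {m : ℤ} {f : Laur} : f ∈ bd m ↔ ∃ g, f = uL ^ m * ofPS g := Iff.rfl

theorem mem_bd_zero {f : Laur} : f ∈ bd 0 ↔ ∃ g, f = ofPS g := by simp [mem_bd]

theorem ofPS_mem_bd (g : PowerSeries ℂ) : ofPS g ∈ bd 0 := mem_bd_zero.2 ⟨g, rfl⟩

theorem uL_zpow_mem_bd (m : ℤ) : uL ^ m ∈ bd m := ⟨1, by simp⟩

theorem bd_mono {m m' : ℤ} (h : m ≤ m') : bd m ≤ bd m' := by
  rintro _ ⟨g, rfl⟩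
  obtain ⟨k, rfl⟩ := Int.le.dest h
  refine ⟨PowerSeries.X ^ k * g, ?_⟩
  rw [map_mul, map_pow, ofPS_X, zpow_add₀ uL_ne_zero, zpow_natCast, inv_pow]
  have := pow_ne_zero k uL_ne_zero
  field_simp

theorem mul_mem_bd {m k : ℤ} {f g : Laur} (hf : f ∈ bd m) (hg : g ∈ bd k) : f * g ∈ bd (m + k) := by
  obtain ⟨a, rfl⟩ := hf
  obtain ⟨b, rfl⟩ := hg
  exact ⟨a * b, by rw [map_mul, zpow_add₀ uL_ne_zero]; ring⟩

theorem coeffU_eq_zero_of_mem_bd {m k : ℤ} (h : m < k) {f : Laur} (hf : f ∈ bd m) :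
    coeffU k f = 0 := by
  obtain ⟨g, rfl⟩ := hf
  rw [coeffU_uL_zpow_mul_ofPS, if_neg (by omega)]

theorem coeffU_uL_zpow (k m : ℤ) : coeffU k (uL ^ m) = if k = m then 1 else 0 := by
  have h := coeffU_uL_zpow_mul_ofPS k m 1
  rw [map_one, mul_one] at h
  rw [h, PowerSeries.coeff_one]
  split_ifs <;> first | rfl | omega

theorem exists_mem_bd (f : Laur) : ∃ N : ℕ, f ∈ bd N := by
  have h := LaurentSeries.single_order_mul_powerSeriesPart (R := ℂ) f
  have h2 : f ∈ bd (-HahnSeries.order (f : LaurentSeries ℂ)) := by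
    refine ⟨LaurentSeries.powerSeriesPart f, ?_⟩
    rw [uL_zpow, neg_neg]
    exact h.symm
  exact ⟨_, bd_mono (Int.self_le_toNat _) h2⟩

theorem exists_forall_mem_bd {ι : Type*} [Finite ι] (f : ι → Laur) :
    ∃ N : ℕ, ∀ i, f i ∈ bd N := by
  have := Fintype.ofFinite ι
  choose N hN using fun i ↦ exists_mem_bd (f i)
  refine ⟨∑ i, N i, fun i ↦ bd_mono ?_ (hN i)⟩
  exact_mod_cast Finset.single_le_sum (f := N) (fun _ _ ↦ Nat.zero_le _) (Finset.mem_univ i)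

/-- The inclusion `ℂ[u] → ℂ((u⁻¹))`. -/
def ofPoly : Polynomial ℂ →ₐ[ℂ] Laur := Polynomial.aeval uL

theorem coeffU_ofPoly (k : ℕ) (a : Polynomial ℂ) : coeffU k (ofPoly a) = a.coeff k := by
  induction a using Polynomial.induction_on' with
  | add a b ha hb => rw [map_add, map_add, ha, hb, Polynomial.coeff_add]
  | monomial j c =>
    rw [ofPoly, Polynomial.aeval_monomial, ← Algebra.smul_def, map_smul, ← zpow_natCast,
      coeffU_uL_zpow, Polynomial.coeff_monomial, smul_eq_mul]
    simp [eq_comm]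

theorem coeffU_ofPoly_of_neg {k : ℤ} (hk : k < 0) (a : Polynomial ℂ) :
    coeffU k (ofPoly a) = 0 := by
  induction a using Polynomial.induction_on' with
  | add a b ha hb => rw [map_add, map_add, ha, hb, add_zero]
  | monomial j c =>
    rw [ofPoly, Polynomial.aeval_monomial, ← Algebra.smul_def, map_smul, ← zpow_natCast,
      coeffU_uL_zpow, if_neg (by omega), smul_zero]

/-- The constant term stays in the power series. The constant term of the polynomial is thus free to
be matched with the dual number component in `exists_pStar_add_emb`. -/
theorem exists_ofPoly_add_ofPS (f : Laur) : ∃ a g, f = ofPoly (Polynomial.X * a) + ofPS g := by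
  obtain ⟨N, g, rfl⟩ := exists_mem_bd f
  induction N with
  | zero => exact ⟨0, g, by simp⟩
  | succ N ih =>
    obtain ⟨a, h, hah⟩ := ih
    obtain ⟨c, h', rfl⟩ : ∃ c h', h = PowerSeries.C c + PowerSeries.X * h' :=
      ⟨_, _, by rw [add_comm]; exact PowerSeries.eq_X_mul_shift_add_const h⟩
    refine ⟨Polynomial.X * a + Polynomial.C c, h', ?_⟩
    have h1 : uL ^ ((N + 1 : ℕ) : ℤ) * ofPS g = uL * (uL ^ (N : ℤ) * ofPS g) := by
      rw [Nat.cast_succ, zpow_add_one₀ uL_ne_zero]; ring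
    have hC : ofPS (PowerSeries.C c) = algebraMap ℂ Laur c := ofPS.commutes c
    have hX : ofPoly Polynomial.X = uL := Polynomial.aeval_X _
    have hCp : ofPoly (Polynomial.C c) = algebraMap ℂ Laur c := Polynomial.aeval_C _ _
    rw [h1, hah]
    simp only [map_add, map_mul, hC, hX, hCp, ofPS_X]
    have := uL_ne_zero
    field_simp
    ring

theorem ofPoly_injective : Function.Injective ofPoly := by
  intro a b h
  ext k
  rw [← coeffU_ofPoly, h, coeffU_ofPoly]

/-! ### Factorization of matrices over `ℂ((u⁻¹))` -/

open Matrix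

/-- A lattice, given by `g`, has a basis in which `ℂ[u]ⁿ` is generated by multiples `u ^ mᵢ`
of the basis vectors, up to an integral matrix `H`. -/
def IsReduction {n : ℕ} (g : Matrix (Fin n) (Fin n) Laur)
    (σ : Matrix (Fin n) (Fin n) (Polynomial ℂ)) (m : Fin n → ℤ)
    (H : Matrix (Fin n) (Fin n) (PowerSeries ℂ)) : Prop :=
  (∃ δ : ℂ, δ ≠ 0 ∧ σ.det = Polynomial.C δ) ∧
    ∀ i j, (g⁻¹ * σ.map ofPoly) i j = ofPS (H i j) * uL ^ m j

/-- Take c in the kernel of H mod u⁻¹ and, among the indices with cᵢ ≠ 0, one with mᵢ maximal.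
Replacing column i of σ by the combination of the columns j with coefficients (cⱼ/cᵢ) u^(mᵢ - mⱼ)
keeps σ polynomial and its determinant fixed. The new column of H is divisible by u⁻¹, so mᵢ drops
by one. -/
theorem IsReduction.exists_lt {n : ℕ} {g : Matrix (Fin n) (Fin n) Laur}
    {σ : Matrix (Fin n) (Fin n) (Polynomial ℂ)} {m : Fin n → ℤ}
    {H : Matrix (Fin n) (Fin n) (PowerSeries ℂ)} (h : IsReduction g σ m H)
    (hH : (H.map (PowerSeries.constantCoeff (R := ℂ))).det = 0) :
    ∃ σ' m' H', IsReduction g σ' m' H' ∧ ∑ i, m' i < ∑ i, m i := by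
  obtain ⟨⟨δ, hδ, hdet⟩, hred⟩ := h
  obtain ⟨c, hc0, hc⟩ := Matrix.exists_mulVec_eq_zero_iff.2 hH
  obtain ⟨i₀, hi₀⟩ := Function.ne_iff.1 hc0
  obtain ⟨i, hi, hmax⟩ := Finset.exists_max_image (Finset.univ.filter fun i ↦ c i ≠ 0) m
    ⟨i₀, by simpa using hi₀⟩
  have hci : c i ≠ 0 := by simpa using hi
  have hmax' : ∀ j, c j ≠ 0 → m j ≤ m i := fun j hj ↦ hmax j (by simpa using hj)
  let w : Fin n → Polynomial ℂ := fun j ↦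
    Polynomial.C (c j / c i) * Polynomial.X ^ (m i - m j).toNat
  have hw : ∀ j, ofPoly (w j) * uL ^ m j = algebraMap ℂ Laur (c j / c i) * uL ^ m i := by
    intro j
    by_cases hj : c j = 0
    · simp [w, hj]
    · have h1 : ((m i - m j).toNat : ℤ) = m i - m j := Int.toNat_of_nonneg (by
        have := hmax' j hj
        omega)
      simp only [w, map_mul, map_pow]
      have hX : ofPoly Polynomial.X = uL := Polynomial.aeval_X _
      have hCp : ofPoly (Polynomial.C (c j / c i)) = algebraMap ℂ Laur (c j / c i) :=
        Polynomial.aeval_C _ _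
      rw [hX, hCp, ← zpow_natCast, h1, mul_assoc, ← zpow_add₀ uL_ne_zero, sub_add_cancel]
  have hwi : w i = 1 := by simp [w, hci]
  have hh : ∀ a, ∃ h : PowerSeries ℂ, ∑ j, H a j * PowerSeries.C (c j / c i) =
      PowerSeries.X * h := by
    intro a
    refine PowerSeries.X_dvd_iff.2 ?_
    have h1 := congrFun hc a
    simp only [Matrix.mulVec, dotProduct, Matrix.map_apply, Pi.zero_apply] at h1
    simp only [map_sum, map_mul, PowerSeries.constantCoeff_C, mul_div_assoc']
    rw [← Finset.sum_div, h1, zero_div]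
  choose h hh using hh
  refine ⟨σ * (1 : Matrix _ _ _).updateCol i w, Function.update m i (m i - 1), H.updateCol i h,
    ⟨⟨δ, hδ, ?_⟩, fun a b ↦ ?_⟩, ?_⟩
  · rw [Matrix.det_mul, ← Matrix.cramer_apply, Matrix.cramer_one, hdet]
    simp [hwi]
  · have h1 : (g⁻¹ * (σ * (1 : Matrix _ _ _).updateCol i w).map ofPoly) a b =
        ∑ j, (g⁻¹ * σ.map ofPoly) a j * ofPoly ((1 : Matrix _ _ _).updateCol i w j b) := by
      rw [Matrix.map_mul, ← Matrix.mul_assoc, Matrix.mul_apply]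
      rfl
    rw [h1]
    by_cases hb : b = i
    · subst hb
      simp only [Matrix.updateCol_self, Function.update_self]
      have h2 : ∀ j, (g⁻¹ * σ.map ofPoly) a j * ofPoly (w j) =
          ofPS (H a j * PowerSeries.C (c j / c b)) * uL ^ m b := by
        intro j
        have hC : ofPS (PowerSeries.C (c j / c b)) = algebraMap ℂ Laur (c j / c b) :=
          ofPS.commutes _
        rw [hred, mul_assoc, mul_comm (uL ^ m j), hw, map_mul, hC, mul_assoc]
      rw [Finset.sum_congr rfl fun j _ ↦ h2 j, ← Finset.sum_mul, ← map_sum, hh, map_mul, ofPS_X,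
        zpow_sub_one₀ uL_ne_zero]
      ring
    · rw [Function.update_of_ne hb, Matrix.updateCol_ne hb, ← hred, Finset.sum_eq_single b]
      · simp [Matrix.updateCol_ne hb]
      · intro j _ hj
        simp [Matrix.updateCol_ne hb, hj]
      · simp
  · rw [Finset.sum_update_of_mem (Finset.mem_univ i),
      ← Finset.add_sum_erase _ m (Finset.mem_univ i), Finset.sdiff_singleton_eq_erase]
    omega

/-- Descent on ∑ mᵢ. Comparing determinants, δ = det g · det H · u^(∑ mᵢ) with δ a nonzero constant,
so ∑ mᵢ is bounded below. At the minimum H is invertible mod u⁻¹ by `IsReduction.exists_lt`. -/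
theorem exists_isReduction {n : ℕ} (g : Matrix (Fin n) (Fin n) Laur) (hg : g.det ≠ 0) :
    ∃ σ m H, IsReduction g σ m H ∧ IsUnit H.det := by
  obtain ⟨D, hD⟩ := exists_mem_bd g.det
  have hbdd : ∀ σ m H, IsReduction g σ m H → -(D : ℤ) ≤ ∑ i, m i := by
    rintro σ m H ⟨⟨δ, hδ, hdet⟩, hred⟩
    by_contra! hlt
    have h1 : g⁻¹ * σ.map ofPoly = H.map ofPS * Matrix.diagonal fun j ↦ uL ^ m j := by
      ext i j
      rw [hred, Matrix.mul_diagonal, Matrix.map_apply]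
    have h2 : algebraMap ℂ Laur δ = g.det * (ofPS H.det * uL ^ ∑ i, m i) := by
      have h3 := congrArg Matrix.det h1
      have h4 : (σ.map ofPoly).det = algebraMap ℂ Laur δ := by
        have := (RingHom.map_det ofPoly.toRingHom σ).symm
        rw [hdet] at this
        exact this.trans (Polynomial.aeval_C _ _)
      have h5 : (H.map ofPS).det = ofPS H.det := (RingHom.map_det ofPS.toRingHom H).symm
      rw [Matrix.det_mul, Matrix.det_mul, Matrix.det_diagonal, h4, h5, Matrix.det_nonsing_inv,
        Ring.inverse_eq_inv'] at h3
      have h6 : ∏ i, uL ^ m i = uL ^ ∑ i, m i := by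
        induction (Finset.univ : Finset (Fin n)) using Finset.induction_on with
        | empty => simp
        | insert a s ha ih => rw [Finset.prod_insert ha, Finset.sum_insert ha, ih,
            zpow_add₀ uL_ne_zero]
      rw [← h6, ← h3, ← mul_assoc, mul_inv_cancel₀ hg, one_mul]
    have h7 : algebraMap ℂ Laur δ ∈ bd (D + (0 + ∑ i, m i)) := by
      rw [h2]
      exact mul_mem_bd hD (mul_mem_bd (ofPS_mem_bd _) (uL_zpow_mem_bd _))
    have h8 := coeffU_eq_zero_of_mem_bd (k := 0) (by omega) h7
    have h9 := coeffU_ofPoly 0 (Polynomial.C δ)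
    rw [show ofPoly (Polynomial.C δ) = algebraMap ℂ Laur δ from Polynomial.aeval_C _ _,
      Polynomial.coeff_C_zero, Nat.cast_zero, h8] at h9
    exact hδ h9.symm
  have hne : ∃ z : ℤ, ∃ σ m H, IsReduction g σ m H ∧ ∑ i, m i = z := by
    obtain ⟨N, hN⟩ := exists_forall_mem_bd fun p : Fin n × Fin n ↦ g⁻¹ p.1 p.2
    choose G hG using fun i j ↦ hN (i, j)
    refine ⟨_, 1, fun _ ↦ N, G, ⟨⟨1, one_ne_zero, by simp⟩, fun i j ↦ ?_⟩, rfl⟩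
    rw [Matrix.map_one _ (map_zero _) (map_one _), Matrix.mul_one, mul_comm]
    exact hG i j
  obtain ⟨z, ⟨σ, m, H, hr, hz⟩, hmin⟩ := Int.exists_least_of_bdd
    (P := fun z ↦ ∃ σ m H, IsReduction g σ m H ∧ ∑ i, m i = z)
    ⟨-(D : ℤ), by rintro _ ⟨σ, m, H, hr, rfl⟩; exact hbdd σ m H hr⟩ hne
  refine ⟨σ, m, H, hr, ?_⟩
  rw [PowerSeries.isUnit_iff_constantCoeff, isUnit_iff_ne_zero]
  intro h0
  obtain ⟨σ', m', H', hr', hlt⟩ := hr.exists_lt (by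
    rw [← h0]; exact (RingHom.map_det PowerSeries.constantCoeff H).symm)
  have := hmin _ ⟨σ', m', H', hr', rfl⟩
  omega

/-- The factorization `g⁻¹ σ = H diag(u ^ mᵢ)` with `σ ∈ SL(n, ℂ[u])`, increasing exponents, and
`H` invertible over `ℂ[[u⁻¹]]`. -/
theorem exists_specialLinear_factorization {n : ℕ} (hn : 0 < n) (g : Matrix (Fin n) (Fin n) Laur)
    (hg : g.det ≠ 0) :
    ∃ (σ : Matrix.SpecialLinearGroup (Fin n) (Polynomial ℂ)) (m : Fin n → ℤ)
      (H : Matrix (Fin n) (Fin n) (PowerSeries ℂ)), Monotone m ∧ IsUnit H.det ∧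
      g⁻¹ * σ.1.map ofPoly = H.map ofPS * Matrix.diagonal fun j ↦ uL ^ m j := by
  obtain ⟨σ, m, H, ⟨⟨δ, hδ, hdet⟩, hred⟩, hH⟩ := exists_isReduction g hg
  set π := Tuple.sort m with hπ
  set ε : ℂ := ((Equiv.Perm.sign π : ℤ) : ℂ) with hε
  have hε2 : ε * ε = 1 := by
    rw [hε, ← Int.cast_mul, ← Units.val_mul, Int.units_mul_self]; simp
  have hε0 : ε ≠ 0 := fun h ↦ by simp [h] at hε2
  -- Sorting the columns multiplies the determinant by the sign ε. Scaling by an n-th root of (ε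
  -- δ)⁻¹ makes it 1.
  obtain ⟨s, hs⟩ := IsAlgClosed.exists_pow_nat_eq ((ε * δ)⁻¹) hn
  have hs0 : s ≠ 0 := by
    rintro rfl
    rw [zero_pow hn.ne'] at hs
    exact inv_ne_zero (mul_ne_zero hε0 hδ) hs.symm
  have hdet' : (Polynomial.C s • σ.submatrix id π).det = 1 := by
    rw [Matrix.det_smul, Matrix.det_permute', hdet, Fintype.card_fin, ← Polynomial.C_pow, hs]
    have h1 : ((Equiv.Perm.sign π : ℤ) : Polynomial ℂ) = Polynomial.C ε := by simp [hε]
    rw [h1, ← Polynomial.C_mul, ← Polynomial.C_mul, inv_mul_cancel₀ (mul_ne_zero hε0 hδ)]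
    simp
  refine ⟨⟨Polynomial.C s • σ.submatrix id π, hdet'⟩, m ∘ π,
    PowerSeries.C s • H.submatrix id π, Tuple.monotone_sort m, ?_, ?_⟩
  · rw [Matrix.det_smul, Matrix.det_permute']
    refine IsUnit.mul (IsUnit.pow _ ?_) (IsUnit.mul ?_ hH)
    · exact (isUnit_iff_ne_zero.2 hs0).map PowerSeries.C
    · exact (Equiv.Perm.sign π).isUnit.map (Int.castRingHom _)
  · change g⁻¹ * (Polynomial.C s • σ.submatrix id π).map ofPoly = _
    ext i j
    have hC : ofPS (PowerSeries.C s) = algebraMap ℂ Laur s := ofPS.commutes s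
    have hCp : ofPoly (Polynomial.C s) = algebraMap ℂ Laur s := Polynomial.aeval_C _ _
    rw [Matrix.mul_diagonal, Matrix.map_apply, Matrix.smul_apply, smul_eq_mul, map_mul, hC,
      Matrix.submatrix_apply, mul_assoc, id, Function.comp_apply, ← hred, Matrix.mul_apply,
      Matrix.mul_apply, Finset.mul_sum]
    refine Finset.sum_congr rfl fun k _ ↦ ?_
    simp only [Matrix.map_apply, Matrix.smul_apply, smul_eq_mul, map_mul, hCp,
      Matrix.submatrix_apply, id]
    ring

/-! ### Conjugating an open bounded Lie algebra into a standard order -/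

theorem exists_int_step {n : ℕ} (m : Fin n → ℤ) (hm : Monotone m) (h : ∀ i j, m j ≤ m i + 1) :
    ∃ k ≤ n, ∀ i j : Fin n, m j - m i =
      (if (j : ℕ) < k then 0 else 1) - (if (i : ℕ) < k then 0 else 1) := by
  by_cases hc : ∀ i j, m i = m j
  · refine ⟨n, le_rfl, fun i j ↦ ?_⟩
    simp [hc i j]
  push Not at hc
  obtain ⟨a, b, hab⟩ := hc
  -- The exponents take two consecutive values, and k is the first index at which m is not minimal.
  have hP : ∃ k : ℕ, ∃ hk : k < n, ∃ i, m i < m ⟨k, hk⟩ := by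
    rcases lt_or_gt_of_ne hab with h1 | h1
    · exact ⟨b, b.2, a, h1⟩
    · exact ⟨a, a.2, b, h1⟩
  classical
  obtain ⟨hk, i₀, hi₀⟩ := Nat.find_spec hP
  have hlow : ∀ i : Fin n, (i : ℕ) < Nat.find hP → m i ≤ m i₀ := fun i hi ↦ by
    have := Nat.find_min hP hi
    push Not at this
    exact this i.2 i₀
  have hhigh : ∀ i : Fin n, ¬ (i : ℕ) < Nat.find hP → m ⟨_, hk⟩ ≤ m i := fun i hi ↦
    hm (by simpa [Fin.le_def] using hi)
  have key : ∀ i : Fin n, m i = m i₀ + (if (i : ℕ) < Nat.find hP then 0 else 1) := by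
    intro i
    split_ifs with hi
    · have h1 := hlow i hi
      have h2 := h i ⟨_, hk⟩
      omega
    · have h1 := hhigh i hi
      have h2 := h i₀ i
      omega
  refine ⟨Nat.find hP, hk.le, fun i j ↦ ?_⟩
  rw [key i, key j]
  ring

/-- Matrices with entries of degree at most `m`, as a module over `ℂ[[u⁻¹]]`. -/
theorem mem_span_single_of_mem_bd {n : ℕ} {m : ℤ} (x : Matrix (Fin n) (Fin n) Laur)
    (hx : ∀ i j, x i j ∈ bd m) :
    x ∈ Submodule.span (PowerSeries ℂ)
      (Set.range fun p : Fin n × Fin n ↦ Matrix.single p.1 p.2 (uL ^ m)) := by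
  rw [Matrix.matrix_eq_sum_single x]
  refine sum_mem fun i _ ↦ sum_mem fun j _ ↦ ?_
  obtain ⟨g, hg⟩ := hx i j
  have : Matrix.single i j (x i j) = g • Matrix.single i j (uL ^ m) := by
    rw [Matrix.smul_single, hg, Algebra.smul_def, mul_comm]
    rfl
  rw [this]
  exact Submodule.smul_mem _ _ (Submodule.subset_span ⟨(i, j), rfl⟩)

/-- A bounded Lie algebra of trace zero matrices that is open and complements the polynomials can be
conjugated by `SL(n, ℂ[u])` into a standard maximal order. -/
theorem exists_conj_mem_bd {n : ℕ} (hn : 2 ≤ n) (W : Set (Matrix (Fin n) (Fin n) Laur)) (M N : ℤ)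
    (hlie : ∀ x ∈ W, ∀ y ∈ W, x * y - y * x ∈ W) (htr : ∀ x ∈ W, x.trace = 0)
    (hM : ∀ x ∈ W, ∀ i j, x i j ∈ bd M)
    (hN : ∀ x : Matrix (Fin n) (Fin n) Laur, x.trace = 0 → (∀ i j, x i j ∈ bd (-N)) → x ∈ W)
    (hsum : ∀ f : Matrix (Fin n) (Fin n) Laur, f.trace = 0 →
      ∃ x ∈ W, ∃ a : Matrix (Fin n) (Fin n) (Polynomial ℂ), f = x + a.map ofPoly) :
    ∃ σ : Matrix.SpecialLinearGroup (Fin n) (Polynomial ℂ), ∃ k ≤ n, ∀ x ∈ W, ∀ i j : Fin n,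
      ((σ⁻¹).1.map ofPoly * x * σ.1.map ofPoly) i j ∈
        bd ((if (j : ℕ) < k then 0 else 1) - (if (i : ℕ) < k then 0 else 1)) := by
  have hn0 : (n : ℂ) ≠ 0 := by exact_mod_cast (by omega : n ≠ 0)
  have hnO : IsUnit (n : PowerSeries ℂ) := by
    have := (isUnit_iff_ne_zero.2 hn0).map (algebraMap ℂ (PowerSeries ℂ))
    rwa [map_natCast] at this
  -- W is only a complex vector space. Its span over ℂ[[u⁻¹]] lies in a finitely generated module by
  -- boundedness, so it is finitely generated, and it is still a Lie algebra.
  set L := Submodule.span (PowerSeries ℂ) W with hL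
  have hLfg : L.FG := by
    have hfg : (Submodule.span (PowerSeries ℂ)
      (Set.range fun p : Fin n × Fin n ↦ Matrix.single p.1 p.2 (uL ^ M))).FG :=
      Submodule.fg_span (Set.finite_range _)
    exact hfg.of_le (Submodule.span_le.2 fun x hx ↦ mem_span_single_of_mem_bd x (hM x hx))
  have hLlie : ∀ x ∈ L, ∀ y ∈ L, x * y - y * x ∈ L := by
    intro x hx y hy
    induction hx, hy using Submodule.span_induction₂ with
    | mem_mem x y hx hy => exact Submodule.subset_span (hlie x hx y hy)
    | zero_left => simp
    | zero_right => simp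
    | add_left x y z _ _ _ h1 h2 =>
      have : (x + y) * z - z * (x + y) = (x * z - z * x) + (y * z - z * y) := by noncomm_ring
      rw [this]; exact add_mem h1 h2
    | add_right x y z _ _ _ h1 h2 =>
      have : x * (y + z) - (y + z) * x = (x * y - y * x) + (x * z - z * x) := by noncomm_ring
      rw [this]; exact add_mem h1 h2
    | smul_left c x y _ _ h =>
      rw [smul_mul_assoc, mul_smul_comm, ← smul_sub]; exact Submodule.smul_mem _ _ h
    | smul_right c x y _ _ h =>
      rw [smul_mul_assoc, mul_smul_comm, ← smul_sub]; exact Submodule.smul_mem _ _ h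
  have hLtr : ∀ x ∈ L, x.trace = 0 := by
    intro x hx
    induction hx using Submodule.span_induction with
    | mem x hx => exact htr x hx
    | zero => simp
    | add x y _ _ h1 h2 => rw [Matrix.trace_add, h1, h2, add_zero]
    | smul c x _ h => rw [Matrix.trace_smul, h, smul_zero]
  have hLspan : ∀ y : Matrix (Fin n) (Fin n) Laur,
      y ∈ Submodule.span Laur (insert 1 (L : Set (Matrix (Fin n) (Fin n) Laur))) := by
    intro y
    have hnL : (n : Laur) ≠ 0 := by
      rw [← map_natCast (algebraMap ℂ Laur)]
      exact (map_ne_zero _).2 hn0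
    set y₀ := y - (y.trace / n) • (1 : Matrix (Fin n) (Fin n) Laur) with hy₀
    have hy₀t : y₀.trace = 0 := by
      rw [hy₀, Matrix.trace_sub, Matrix.trace_smul, Matrix.trace_one, Fintype.card_fin,
        smul_eq_mul, div_mul_cancel₀ _ hnL, sub_self]
    obtain ⟨K, hK⟩ := exists_forall_mem_bd fun p : Fin n × Fin n ↦ y₀ p.1 p.2
    -- W is open: a high power of u⁻¹ moves any trace zero matrix into it, so L spans sl(n) over the
    -- field.
    have hz : uL ^ (-N - K) • y₀ ∈ W := by
      refine hN _ (by rw [Matrix.trace_smul, hy₀t, smul_zero]) fun i j ↦ ?_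
      have := mul_mem_bd (uL_zpow_mem_bd (-N - K)) (hK (i, j))
      rwa [sub_add_cancel] at this
    have h1 : y = (y.trace / n) • (1 : Matrix (Fin n) (Fin n) Laur) +
        uL ^ (N + K) • (uL ^ (-N - K) • y₀) := by
      rw [smul_smul, ← zpow_add₀ uL_ne_zero]
      have : N + (K : ℤ) + (-N - K) = 0 := by ring
      rw [this, zpow_zero, one_smul, hy₀]
      abel
    rw [h1]
    refine add_mem (Submodule.smul_mem _ _ (Submodule.subset_span (by simp)))
      (Submodule.smul_mem _ _ (Submodule.subset_span (Set.mem_insert_of_mem _ ?_)))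
    exact Submodule.subset_span hz
  obtain ⟨g, hg, hLg⟩ := exists_conj_integral hnO L hLfg hLlie hLtr hLspan
  obtain ⟨σ, m, H, hm, hH, hfac⟩ := exists_specialLinear_factorization (by omega) g hg
  set S := σ.1.map ofPoly with hS
  set S' := (σ⁻¹).1.map ofPoly with hS'
  have hSS' : S * S' = 1 := by
    rw [hS, hS', ← Matrix.map_mul, ← Matrix.SpecialLinearGroup.coe_mul, mul_inv_cancel]
    simp
  have hS'S : S' * S = 1 := by
    rw [hS, hS', ← Matrix.map_mul, ← Matrix.SpecialLinearGroup.coe_mul, inv_mul_cancel]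
    simp
  set D := Matrix.diagonal fun j ↦ uL ^ m j with hD
  set D' := Matrix.diagonal fun j ↦ uL ^ (-m j) with hD'
  have hDD' : D' * D = 1 := by
    rw [hD, hD', Matrix.diagonal_mul_diagonal, ← Matrix.diagonal_one]
    congr 1
    funext j
    rw [← zpow_add₀ uL_ne_zero, neg_add_cancel, zpow_zero]
  have hHH : H⁻¹.map ofPS * H.map ofPS = 1 := by
    rw [← Matrix.map_mul, Matrix.nonsing_inv_mul _ hH]
    simp
  have hgu : IsUnit g.det := isUnit_iff_ne_zero.2 hg
  have hSg : S = g * (H.map ofPS * D) := by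
    rw [← hfac, ← Matrix.mul_assoc, Matrix.mul_nonsing_inv _ hgu, Matrix.one_mul]
  have hS'g : S' = D' * H⁻¹.map ofPS * g⁻¹ := by
    have h1 : (D' * H⁻¹.map ofPS * g⁻¹) * S = 1 := by
      rw [hSg]
      calc D' * H⁻¹.map ofPS * g⁻¹ * (g * (H.map ofPS * D))
          = D' * (H⁻¹.map ofPS * (g⁻¹ * g) * H.map ofPS) * D := by simp only [Matrix.mul_assoc]
        _ = 1 := by
          rw [Matrix.nonsing_inv_mul _ hgu, Matrix.mul_one, hHH, Matrix.mul_one, hDD']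
    calc S' = ((D' * H⁻¹.map ofPS * g⁻¹) * S) * S' := by rw [h1, Matrix.one_mul]
      _ = _ := by rw [Matrix.mul_assoc, hSS', Matrix.mul_one]
  have hconj : ∀ x ∈ W, ∀ i j, (S' * x * S) i j ∈ bd (m j - m i) := by
    intro x hx i j
    obtain ⟨y, hy⟩ := hLg x (Submodule.subset_span hx)
    change x * g = g * y.map ofPS at hy
    have h1 : S' * x * S = D' * (H⁻¹ * y * H).map ofPS * D := by
      rw [hS'g, hSg, Matrix.map_mul, Matrix.map_mul]
      calc D' * H⁻¹.map ofPS * g⁻¹ * x * (g * (H.map ofPS * D))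
          = D' * H⁻¹.map ofPS * g⁻¹ * (x * g) * (H.map ofPS * D) := by
            simp only [Matrix.mul_assoc]
        _ = D' * (H⁻¹.map ofPS * ((g⁻¹ * g) * y.map ofPS) * H.map ofPS) * D := by
            rw [hy]; simp only [Matrix.mul_assoc]
        _ = _ := by rw [Matrix.nonsing_inv_mul _ hgu, Matrix.one_mul, ← Matrix.mul_assoc]
    rw [h1, Matrix.mul_diagonal, Matrix.diagonal_mul, Matrix.map_apply]
    have h2 := mul_mem_bd (mul_mem_bd (uL_zpow_mem_bd (-m i)) (ofPS_mem_bd ((H⁻¹ * y * H) i j)))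
      (uL_zpow_mem_bd (m j))
    have h3 : -m i + 0 + m j = m j - m i := by ring
    rwa [h3] at h2
  have hstep : ∀ i j, m i ≤ m j + 1 := by
    intro i j
    by_cases hij : i = j
    · subst hij; omega
    -- If mᵢ > mⱼ + 1, then u⁻¹ does not occur in the (i, j) entry of the conjugate of W. It does
    -- not occur in a polynomial either, yet u⁻¹Eᵢⱼ is a sum of the two.
    by_contra! hlt
    let f := Matrix.single i j (uL ^ (-1 : ℤ))
    obtain ⟨x, hx, a, hxa⟩ := hsum (S * f * S') (by
      rw [Matrix.trace_mul_comm, ← Matrix.mul_assoc, hS'S, Matrix.one_mul]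
      exact Matrix.trace_single_eq_of_ne _ _ _ hij)
    have h1 : f = S' * x * S + ((σ⁻¹).1 * a * σ.1).map ofPoly := by
      calc f = (S' * S) * f * (S' * S) := by rw [hS'S, Matrix.one_mul, Matrix.mul_one]
        _ = S' * (S * f * S') * S := by simp only [Matrix.mul_assoc]
        _ = _ := by
          rw [hxa, Matrix.mul_add, Matrix.add_mul, Matrix.map_mul, Matrix.map_mul]
    have h2 := congrArg (fun y : Matrix (Fin n) (Fin n) Laur ↦ coeffU (-1) (y i j)) h1
    simp only [Matrix.add_apply, map_add, Matrix.map_apply] at h2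
    rw [coeffU_eq_zero_of_mem_bd (by omega) (hconj x hx i j),
      coeffU_ofPoly_of_neg (by norm_num)] at h2
    simp only [f, Matrix.single_apply_same, coeffU_uL_zpow] at h2
    norm_num at h2
  obtain ⟨k, hk, hmk⟩ := exists_int_step m hm fun i j ↦ hstep j i
  exact ⟨σ, k, hk, fun x hx i j ↦ by rw [← hmk]; exact hconj x hx i j⟩

/-- A criterion for membership in the maximal order `W_k`. -/
theorem mem_Wk {n k : ℕ} (x : Double n) (hx : ∀ i j : Fin n, x.1.1 i j ∈
    bd ((if (j : ℕ) < k then 0 else 1) - (if (i : ℕ) < k then 0 else 1))) : x ∈ Wk n k := by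
  choose y hy using hx
  set e : Fin n → ℤ := fun i ↦ if (i : ℕ) < k then 0 else 1 with he
  have hd : dMat n k = Matrix.diagonal fun i ↦ uL ^ e i := by
    rw [dMat]
    congr 1
    funext i
    simp only [he]
    split_ifs <;> simp
  have hdet : IsUnit (dMat n k).det := by
    rw [hd, Matrix.det_diagonal, isUnit_iff_ne_zero, Finset.prod_ne_zero_iff]
    exact fun i _ ↦ zpow_ne_zero _ uL_ne_zero
  have hdx : dMat n k * x.1.1 = (Matrix.of y).map ofPS * dMat n k := by
    ext i j
    rw [hd, Matrix.diagonal_mul, Matrix.mul_diagonal, Matrix.map_apply, Matrix.of_apply, hy,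
      ← mul_assoc, ← zpow_add₀ uL_ne_zero]
    change uL ^ (e i + (e j - e i)) * _ = _
    rw [add_sub_cancel, mul_comm]
  have hx1 : x.1.1 = (dMat n k)⁻¹ * (Matrix.of y).map ofPS * dMat n k := by
    rw [Matrix.mul_assoc, ← hdx, ← Matrix.mul_assoc, Matrix.nonsing_inv_mul _ hdet, Matrix.one_mul]
  have htr : (Matrix.of y).trace = 0 := by
    apply ofPS_injective
    have h1 : Matrix.trace x.1.1 = 0 := x.1.2
    rw [hx1, Matrix.trace_mul_comm, ← Matrix.mul_assoc, Matrix.mul_nonsing_inv _ hdet,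
      Matrix.one_mul] at h1
    rw [map_zero, ← h1]
    exact AddMonoidHom.map_trace ofPS.toRingHom.toAddMonoidHom (Matrix.of y)
  exact ⟨⟨Matrix.of y, htr⟩, hx1⟩

variable {n : ℕ}

/-! ### The form on the double -/

theorem trace_map_linear {A B : Type} [CommRing A] [Algebra ℂ A] [CommRing B] [Algebra ℂ B]
    (f : A →ₗ[ℂ] B) (x : Matrix (Fin n) (Fin n) A) : (x.map f).trace = f x.trace := by
  simp [Matrix.trace, map_sum]

theorem trace_eq_zero_of_map_ofPS {g : Matrix (Fin n) (Fin n) (PowerSeries ℂ)}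
    (h : (g.map ofPS).trace = 0) : g.trace = 0 :=
  ofPS_injective (by
    rw [map_zero, ← h]
    exact (trace_map_linear ofPS.toLinearMap g).symm)

/-- Both Killing forms are 2n times a trace, and the two mixed terms of `Q` are the ε coefficient of
one trace over the dual numbers. Symmetry and invariance of `Q` thus reduce to trace identities over
commutative rings. -/
theorem Q_apply (x y : Double n) : Q n x y =
    2 * n * (res (uL⁻¹ ^ 2 * (x.1.1 * y.1.1).trace) -
      TrivSqZeroExt.snd (x.2.1 * y.2.1).trace) := by
  have h1 : res (uL⁻¹ ^ 2 * killingL n x.1 y.1) =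
      2 * n * res (uL⁻¹ ^ 2 * (x.1.1 * y.1.1).trace) := by
    rw [killingL, killingForm_sl]
    have h2 : uL⁻¹ ^ 2 * (2 * (n : Laur) * (x.1.1 * y.1.1).trace) =
        (2 * n : ℂ) • (uL⁻¹ ^ 2 * (x.1.1 * y.1.1).trace) := by
      rw [Algebra.smul_def]
      simp only [map_mul, map_ofNat, map_natCast]
      ring
    rw [h2, map_smul, smul_eq_mul]
  have h3 : TrivSqZeroExt.snd (x.2.1 * y.2.1).trace =
      ((dualFst n x.2).1 * (dualSnd n y.2).1).trace +
        ((dualSnd n x.2).1 * (dualFst n y.2).1).trace := by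
    simp only [Matrix.trace, Matrix.diag_apply, Matrix.mul_apply, TrivSqZeroExt.snd_sum,
      DualNumber.snd_mul, ← Finset.sum_add_distrib]
    rfl
  have h4 : Q n x y = res (uL⁻¹ ^ 2 * killingL n x.1 y.1)
      - killing n (dualFst n x.2) (dualSnd n y.2) - killing n (dualSnd n x.2) (dualFst n y.2) := rfl
  rw [h4, h1, killing, killingForm_sl, killingForm_sl, h3]
  ring

theorem killing_apply (x y : 𝔤 n) : killing n x y = 2 * n * (x.1 * y.1).trace :=
  killingForm_sl n x y

theorem killing_comm (x y : 𝔤 n) : killing n x y = killing n y x := by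
  rw [killing_apply, killing_apply, Matrix.trace_mul_comm]

theorem killing_lie (x y z : 𝔤 n) : killing n ⁅x, y⁆ z = killing n x ⁅y, z⁆ := by
  rw [killing_apply, killing_apply]
  change 2 * (n : ℂ) * ((x.1 * y.1 - y.1 * x.1) * z.1).trace =
    2 * (n : ℂ) * (x.1 * (y.1 * z.1 - z.1 * y.1)).trace
  rw [Matrix.sub_mul, Matrix.mul_sub, Matrix.trace_sub, Matrix.trace_sub, Matrix.mul_assoc,
    Matrix.mul_assoc y.1, Matrix.trace_mul_comm y.1, Matrix.mul_assoc]

theorem Q_comm (x y : Double n) : Q n x y = Q n y x := by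
  rw [Q_apply, Q_apply, Matrix.trace_mul_comm, Matrix.trace_mul_comm x.2.1]

theorem Q_lie (x y z : Double n) : Q n ⁅x, y⁆ z = Q n x ⁅y, z⁆ := by
  rw [Q_apply, Q_apply]
  have h : ∀ {A : Type} [CommRing A] (a b c : Matrix (Fin n) (Fin n) A),
      ((a * b - b * a) * c).trace = (a * (b * c - c * b)).trace := by
    intro A _ a b c
    rw [Matrix.sub_mul, Matrix.mul_sub, Matrix.trace_sub, Matrix.trace_sub, Matrix.mul_assoc,
      Matrix.mul_assoc b, Matrix.trace_mul_comm b, Matrix.mul_assoc]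
  change 2 * (n : ℂ) * (res (uL⁻¹ ^ 2 * ((x.1.1 * y.1.1 - y.1.1 * x.1.1) * z.1.1).trace) -
      TrivSqZeroExt.snd ((x.2.1 * y.2.1 - y.2.1 * x.2.1) * z.2.1).trace) =
    2 * (n : ℂ) * (res (uL⁻¹ ^ 2 * (x.1.1 * (y.1.1 * z.1.1 - z.1.1 * y.1.1)).trace) -
      TrivSqZeroExt.snd (x.2.1 * (y.2.1 * z.2.1 - z.2.1 * y.2.1)).trace)
  rw [h, h]

theorem res_eq_zero_of_mem_bd {m : ℤ} (h : m ≤ 0) {f : Laur} (hf : f ∈ bd m) :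
    res (uL⁻¹ ^ 2 * f) = 0 := by
  have h2 : uL⁻¹ ^ 2 ∈ bd (-2) := by
    have h3 : uL⁻¹ ^ 2 = uL ^ (-2 : ℤ) := by
      rw [_root_.zpow_neg, inv_pow]; norm_cast
    rw [h3]; exact uL_zpow_mem_bd _
  exact coeffU_eq_zero_of_mem_bd (by omega) (mul_mem_bd h2 hf)

theorem trace_mul_mem_bd {a b : ℤ} {x y : Matrix (Fin n) (Fin n) Laur}
    (hx : ∀ i j, x i j ∈ bd a) (hy : ∀ i j, y i j ∈ bd b) : (x * y).trace ∈ bd (a + b) :=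
  sum_mem fun i _ ↦ (sum_mem fun j _ ↦ mul_mem_bd (hx i j) (hy j i) :
    ∑ j, x i j * y j i ∈ bd (a + b))

theorem Q_eq_zero_of_mem_bd {a b : ℤ} (hab : a + b ≤ 0) {x y : Double n} (hx2 : x.2 = 0)
    (hx : ∀ i j, x.1.1 i j ∈ bd a) (hy : ∀ i j, y.1.1 i j ∈ bd b) : Q n x y = 0 := by
  rw [Q_apply, res_eq_zero_of_mem_bd hab (trace_mul_mem_bd hx hy), hx2]
  simp

theorem emb_fst (a : P n) : (emb n a).1.1 = a.1.map ofPoly := rfl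

theorem emb_snd (a : P n) :
    (emb n a).2.1 = a.1.map (Polynomial.aeval (R := ℂ) (DualNumber.eps : DualNumber ℂ)) := rfl

theorem emb_lie (a b : P n) : emb n ⁅a, b⁆ = ⁅emb n a, emb n b⁆ := by
  refine Prod.ext (Subtype.ext ?_) (Subtype.ext ?_)
  · change (a.1 * b.1 - b.1 * a.1).map ofPoly =
      a.1.map ofPoly * b.1.map ofPoly - b.1.map ofPoly * a.1.map ofPoly
    rw [Matrix.map_sub _ (map_sub _), Matrix.map_mul, Matrix.map_mul]
  · let φ := Polynomial.aeval (R := ℂ) (DualNumber.eps : DualNumber ℂ)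
    change (a.1 * b.1 - b.1 * a.1).map φ = a.1.map φ * b.1.map φ - b.1.map φ * a.1.map φ
    rw [Matrix.map_sub _ (map_sub _), Matrix.map_mul, Matrix.map_mul]

theorem aeval_eps_monomial (k : ℕ) (c : ℂ) :
    Polynomial.aeval (DualNumber.eps : DualNumber ℂ) (Polynomial.monomial k c) =
      if k = 0 then TrivSqZeroExt.inl c else if k = 1 then TrivSqZeroExt.inr c else 0 := by
  rw [Polynomial.aeval_monomial]
  rcases k with _ | _ | k
  · simp [TrivSqZeroExt.algebraMap_eq_inl]
  · ext <;> simp [TrivSqZeroExt.algebraMap_eq_inl]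
  · rw [pow_succ, pow_succ, mul_assoc (DualNumber.eps ^ k), DualNumber.eps_mul_eps]
    simp

/-- Both sides are the coefficient of u in f. This cancellation between the two summands of the
double is what makes `P` isotropic. -/
theorem res_ofPoly (f : Polynomial ℂ) : res (uL⁻¹ ^ 2 * ofPoly f) =
    TrivSqZeroExt.snd (Polynomial.aeval (DualNumber.eps : DualNumber ℂ) f) := by
  induction f using Polynomial.induction_on' with
  | add a b ha hb => simp only [map_add, mul_add, TrivSqZeroExt.snd_add, ha, hb]
  | monomial k c =>
    rw [aeval_eps_monomial, ofPoly, Polynomial.aeval_monomial, ← Algebra.smul_def, mul_smul_comm,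
      map_smul, inv_pow]
    have h : (uL ^ 2)⁻¹ * uL ^ k = uL ^ ((k : ℤ) - 2) := by
      rw [zpow_sub₀ uL_ne_zero, zpow_natCast, div_eq_mul_inv, mul_comm]; norm_cast
    rw [h, res, coeffU_uL_zpow]
    rcases k with _ | _ | k
    · simp
    · simp
    · rw [if_neg (by push_cast; omega)]; simp

theorem Q_emb_emb (a b : P n) : Q n (emb n a) (emb n b) = 0 := by
  rw [Q_apply, emb_fst, emb_fst, emb_snd, emb_snd, ← Matrix.map_mul, ← Matrix.map_mul]
  have h1 := trace_map_linear ofPoly.toLinearMap (a.1 * b.1)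
  have h2 := trace_map_linear
    (Polynomial.aeval (R := ℂ) (DualNumber.eps : DualNumber ℂ)).toLinearMap (a.1 * b.1)
  change ((a.1 * b.1).map ofPoly).trace = ofPoly _ at h1
  change ((a.1 * b.1).map (Polynomial.aeval (R := ℂ) (DualNumber.eps : DualNumber ℂ))).trace =
    Polynomial.aeval (R := ℂ) (DualNumber.eps : DualNumber ℂ) _ at h2
  rw [h1, h2, res_ofPoly, sub_self, mul_zero]

/-- `P*` as a subspace. -/
def pStar (n : ℕ) : Submodule ℂ (Double n) :=
  (LinearMap.range (slMap n ofPS.toLinearMap)).comap (LinearMap.fst ℂ _ _) ⊓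
    LinearMap.ker (dualFst n ∘ₗ LinearMap.snd ℂ _ _)

theorem fst_mem_bd_of_mem_pStar {x : Double n} (hx : x ∈ pStar n) (i j : Fin n) :
    x.1.1 i j ∈ bd 0 := by
  obtain ⟨⟨g, hg⟩, -⟩ := hx
  have : x.1.1 = g.1.map ofPS := congrArg Subtype.val hg.symm
  rw [this]
  exact ofPS_mem_bd _

theorem fst_snd_of_mem_pStar {x : Double n} (hx : x ∈ pStar n) (i j : Fin n) :
    TrivSqZeroExt.fst (x.2.1 i j) = 0 :=
  congrFun (congrFun (congrArg Subtype.val (show dualFst n x.2 = 0 from hx.2)) i) j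

theorem Q_pStar {x y : Double n} (hx : x ∈ pStar n) (hy : y ∈ pStar n) : Q n x y = 0 := by
  rw [Q_apply, res_eq_zero_of_mem_bd (by norm_num)
    (trace_mul_mem_bd (fst_mem_bd_of_mem_pStar hx) (fst_mem_bd_of_mem_pStar hy))]
  have : TrivSqZeroExt.snd (x.2.1 * y.2.1).trace = 0 := by
    simp only [Matrix.trace, Matrix.diag_apply, Matrix.mul_apply, TrivSqZeroExt.snd_sum,
      DualNumber.snd_mul, fst_snd_of_mem_pStar hx, fst_snd_of_mem_pStar hy]
    simp
  rw [this]
  simp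

/-- The terms of positive degree of a are those of the Laurent component, and its constant term is
A₀, as required for the remainder to have only an ε part. What is left over in degree zero is
absorbed by 𝔤[[u⁻¹]]. -/
theorem exists_pStar_add_emb (x : Double n) : ∃ w ∈ pStar n, ∃ a : P n, x = w + emb n a := by
  choose α g h using fun i j ↦ exists_ofPoly_add_ofPS (x.1.1 i j)
  have htr : Polynomial.X * (Matrix.of α).trace = 0 := by
    have h1 : ofPoly (Polynomial.X * (Matrix.of α).trace) + ofPS (Matrix.of g).trace = 0 := by
      have h2 : Matrix.trace x.1.1 = 0 := x.1.2
      rw [← h2]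
      simp only [Matrix.trace, Matrix.diag_apply, h, Finset.sum_add_distrib, Finset.mul_sum,
        map_sum, Matrix.of_apply]
    ext k
    rcases k with _ | k
    · simp
    · have h3 := congrArg (coeffU ((k + 1 : ℕ) : ℤ)) h1
      rw [map_add, coeffU_ofPoly, map_zero, coeffU_eq_zero_of_mem_bd (m := 0) (by positivity)
        (ofPS_mem_bd _), add_zero] at h3
      rw [h3]; simp
  let a : P n := ⟨Matrix.of fun i j ↦ Polynomial.X * α i j +
    Polynomial.C (TrivSqZeroExt.fst (x.2.1 i j)), by
      have h1 : TrivSqZeroExt.fst (Matrix.trace x.2.1) = 0 := by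
        have h2 : Matrix.trace x.2.1 = 0 := x.2.2
        rw [h2]; rfl
      change Matrix.trace (n := Fin n) _ = 0
      simp only [Matrix.trace, Matrix.diag_apply, Matrix.of_apply, Finset.sum_add_distrib,
        ← Finset.mul_sum, ← map_sum] at htr ⊢
      rw [htr, zero_add]
      simp only [Matrix.trace, Matrix.diag_apply, TrivSqZeroExt.fst_sum] at h1
      rw [h1, map_zero]⟩
  refine ⟨x - emb n a, ⟨?_, ?_⟩, a, by abel⟩
  · have h0 : ∀ i j, (x - emb n a).1.1 i j =
        ofPS (g i j - PowerSeries.C (TrivSqZeroExt.fst (x.2.1 i j))) := by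
      intro i j
      change x.1.1 i j - ofPoly (Polynomial.X * α i j +
        Polynomial.C (TrivSqZeroExt.fst (x.2.1 i j))) = _
      have hC : ∀ c, ofPS (PowerSeries.C c) = algebraMap ℂ Laur c := ofPS.commutes
      have hCp : ∀ c, ofPoly (Polynomial.C c) = algebraMap ℂ Laur c := Polynomial.aeval_C _
      rw [h, map_add, map_sub, hC, hCp]
      ring
    refine ⟨⟨Matrix.of fun i j ↦ g i j - PowerSeries.C (TrivSqZeroExt.fst (x.2.1 i j)), ?_⟩,
      Subtype.ext (Matrix.ext fun i j ↦ (h0 i j).symm)⟩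
    refine trace_eq_zero_of_map_ofPS ?_
    have h1 : Matrix.trace (x - emb n a).1.1 = 0 := (x - emb n a).1.2
    rw [← h1]
    simp only [Matrix.trace, Matrix.diag_apply, h0, Matrix.of_apply, Matrix.map_apply]
  · change dualFst n (x - emb n a).2 = 0
    refine Subtype.ext (Matrix.ext fun i j ↦ ?_)
    change TrivSqZeroExt.fst (x.2.1 i j - Polynomial.aeval (DualNumber.eps : DualNumber ℂ)
      (Polynomial.X * α i j + Polynomial.C (TrivSqZeroExt.fst (x.2.1 i j)))) = 0
    simp [TrivSqZeroExt.algebraMap_eq_inl]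

/-! ### The subspace of a skew-symmetric polynomial -/

theorem contract_tmul (w : Double n) (a b : P n) :
    contract w (a ⊗ₜ b) = Q n w (emb n a) • emb n b := by
  simp [contract]

theorem contract_add (w : Double n) (p q : P n ⊗[ℂ] P n) :
    contract w (p + q) = contract w p + contract w q := by
  simp [contract]

theorem contract_zero (w : Double n) : contract w (0 : P n ⊗[ℂ] P n) = 0 := by
  simp [contract]

/-- `w ↦ w + (Q(w, ·) ⊗ id) p`. -/
def graphMap (p : P n ⊗[ℂ] P n) : Double n →ₗ[ℂ] Double n where
  toFun w := w + contract w p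
  map_add' x y := by
    have : contract (x + y) p = contract x p + contract y p := by
      simp only [contract, map_add, LinearMap.add_comp, TensorProduct.map_add_left,
        LinearMap.add_apply]
    rw [this]; abel
  map_smul' c x := by
    have : contract (c • x) p = c • contract x p := by
      simp only [contract, map_smul, LinearMap.smul_comp, TensorProduct.map_smul_left,
        LinearMap.smul_apply]
    rw [this, RingHom.id_apply, smul_add]

theorem graphMap_apply (p : P n ⊗[ℂ] P n) (w : Double n) :
    graphMap p w = w + contract w p := rfl

theorem contract_eq_emb (w : Double n) (p : P n ⊗[ℂ] P n) :
    contract w p = emb n (TensorProduct.lid ℂ (P n)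
      (TensorProduct.map (Q n w ∘ₗ emb n) LinearMap.id p)) := by
  induction p with
  | zero => simp [contract]
  | tmul a b => simp [contract_tmul]
  | add p q hp hq => rw [contract_add, hp, hq]; simp

theorem Q_contract_left (w w' : Double n) (p : P n ⊗[ℂ] P n) :
    Q n (contract w p) w' = TensorProduct.lid ℂ ℂ
      (TensorProduct.map (Q n w ∘ₗ emb n) (Q n w' ∘ₗ emb n) p) := by
  induction p with
  | zero => simp [contract]
  | tmul a b => simp [contract_tmul, Q_comm w']
  | add p q hp hq => rw [contract_add, map_add, LinearMap.add_apply, hp, hq]; simp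

theorem Q_contract_right (w w' : Double n) (p : P n ⊗[ℂ] P n) :
    Q n w (contract w' p) = TensorProduct.lid ℂ ℂ (TensorProduct.map (Q n w ∘ₗ emb n)
      (Q n w' ∘ₗ emb n) (TensorProduct.comm ℂ (P n) (P n) p)) := by
  induction p with
  | zero => simp [contract]
  | tmul a b => simp [contract_tmul, mul_comm]
  | add p q hp hq => rw [contract_add, map_add, hp, hq]; simp

/-- The subspace `{w + (Q(w, ·) ⊗ id) p | w ∈ P*}`. -/
def graphSub (p : P n ⊗[ℂ] P n) : Submodule ℂ (Double n) := (pStar n).map (graphMap p)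

/-- `P*` and `P` are isotropic, so only the two mixed terms remain, and these cancel because p is
skew. -/
theorem Q_graphSub {p : P n ⊗[ℂ] P n} (hp : TensorProduct.comm ℂ (P n) (P n) p = -p)
    {x y : Double n} (hx : x ∈ graphSub p) (hy : y ∈ graphSub p) : Q n x y = 0 := by
  obtain ⟨w, hw, rfl⟩ := hx
  obtain ⟨w', hw', rfl⟩ := hy
  rw [graphMap_apply, graphMap_apply, map_add, map_add, LinearMap.add_apply, LinearMap.add_apply,
    Q_pStar hw hw', Q_contract_left, Q_contract_right, hp, contract_eq_emb, contract_eq_emb,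
    Q_emb_emb]
  simp

theorem exists_graphSub_add_emb (p : P n ⊗[ℂ] P n) (x : Double n) :
    ∃ y ∈ graphSub p, ∃ a : P n, x = y + emb n a := by
  obtain ⟨w, hw, a, rfl⟩ := exists_pStar_add_emb x
  refine ⟨graphMap p w, ⟨w, hw, rfl⟩, a - TensorProduct.lid ℂ (P n)
    (TensorProduct.map (Q n w ∘ₗ emb n) LinearMap.id p), ?_⟩
  rw [map_sub, ← contract_eq_emb, graphMap_apply]
  abel

theorem exists_contract_mem_bd (p : P n ⊗[ℂ] P n) :
    ∃ M : ℕ, ∀ w i j, (contract w p).1.1 i j ∈ bd M := by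
  induction p with
  | zero => exact ⟨0, fun w i j ↦ by rw [contract_zero]; exact zero_mem _⟩
  | tmul a b =>
    obtain ⟨M, hM⟩ := exists_forall_mem_bd fun q : Fin n × Fin n ↦ (emb n b).1.1 q.1 q.2
    refine ⟨M, fun w i j ↦ ?_⟩
    rw [contract_tmul]
    exact Submodule.smul_mem _ _ (hM (i, j))
  | add p q hp hq =>
    obtain ⟨M, hM⟩ := hp
    obtain ⟨N, hN⟩ := hq
    refine ⟨max M N, fun w i j ↦ ?_⟩
    rw [contract_add]
    exact add_mem (bd_mono (by simp) (hM w i j)) (bd_mono (by simp) (hN w i j))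

theorem exists_graphSub_mem_bd (p : P n ⊗[ℂ] P n) :
    ∃ M : ℕ, ∀ x ∈ graphSub p, ∀ i j, x.1.1 i j ∈ bd M := by
  obtain ⟨M, hM⟩ := exists_contract_mem_bd p
  refine ⟨M, ?_⟩
  rintro _ ⟨w, hw, rfl⟩ i j
  exact add_mem (bd_mono (by positivity) (fst_mem_bd_of_mem_pStar hw i j)) (hM w i j)

/-- Only finitely many polynomials occur in p, and elements of sufficiently negative degree are
orthogonal to all of them. Such elements therefore belong to `graphSub p` unchanged. -/
theorem exists_contract_eq_zero (p : P n ⊗[ℂ] P n) :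
    ∃ N : ℕ, ∀ w : Double n, w.2 = 0 → (∀ i j, w.1.1 i j ∈ bd (-N)) → contract w p = 0 := by
  induction p with
  | zero => exact ⟨0, fun w _ _ ↦ contract_zero w⟩
  | tmul a b =>
    obtain ⟨M, hM⟩ := exists_forall_mem_bd fun q : Fin n × Fin n ↦ (emb n a).1.1 q.1 q.2
    refine ⟨M, fun w h2 h1 ↦ ?_⟩
    rw [contract_tmul, Q_eq_zero_of_mem_bd (by omega) h2 h1 fun i j ↦ hM (i, j), zero_smul]
  | add p q hp hq =>
    obtain ⟨M, hM⟩ := hp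
    obtain ⟨N, hN⟩ := hq
    refine ⟨max M N, fun w h2 h1 ↦ ?_⟩
    rw [contract_add, hM w h2 fun i j ↦ bd_mono (by push_cast; omega) (h1 i j),
      hN w h2 fun i j ↦ bd_mono (by push_cast; omega) (h1 i j), add_zero]

theorem mem_pStar_of_mem_bd {x : Double n} (h2 : x.2 = 0) (h1 : ∀ i j, x.1.1 i j ∈ bd 0) :
    x ∈ pStar n := by
  choose g hg using fun i j ↦ mem_bd_zero.1 (h1 i j)
  refine ⟨⟨⟨Matrix.of g, ?_⟩, Subtype.ext (Matrix.ext fun i j ↦ (hg i j).symm)⟩, ?_⟩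
  · refine trace_eq_zero_of_map_ofPS ?_
    have h3 : Matrix.trace x.1.1 = 0 := x.1.2
    rw [← h3]
    simp only [Matrix.trace, Matrix.diag_apply, hg, Matrix.of_apply, Matrix.map_apply]
  · change dualFst n x.2 = 0
    rw [h2, map_zero]

/-! ### Test elements -/

/-- The element `(c u z / (u - c), -z ε)` of the double. -/
def testElt (c : ℂ) : 𝔤 n →ₗ[ℂ] Double n :=
  (slMap n (LinearMap.toSpanSingleton ℂ Laur
    (ofPS (PowerSeries.mk fun k ↦ c ^ (k + 1))))).prod
  (slMap n (LinearMap.toSpanSingleton ℂ (DualNumber ℂ) (-DualNumber.eps)))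

theorem testElt_fst_apply (c : ℂ) (z : 𝔤 n) (i j : Fin n) :
    (testElt c z).1.1 i j = z.1 i j • ofPS (PowerSeries.mk fun k ↦ c ^ (k + 1)) := rfl

theorem testElt_snd_apply (c : ℂ) (z : 𝔤 n) (i j : Fin n) :
    (testElt c z).2.1 i j = z.1 i j • (-DualNumber.eps : DualNumber ℂ) := rfl

theorem testElt_mem_pStar (c : ℂ) (z : 𝔤 n) : testElt c z ∈ pStar n := by
  refine ⟨⟨slMap n (LinearMap.toSpanSingleton ℂ (PowerSeries ℂ)
    (PowerSeries.mk fun k ↦ c ^ (k + 1))) z, Subtype.ext (Matrix.ext fun i j ↦ ?_)⟩, ?_⟩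
  · exact map_smul ofPS _ _
  · change dualFst n (testElt c z).2 = 0
    refine Subtype.ext (Matrix.ext fun i j ↦ ?_)
    change TrivSqZeroExt.fst (z.1 i j • (-DualNumber.eps : DualNumber ℂ)) = 0
    simp

theorem ev_apply (c : ℂ) (a : P n) (i j : Fin n) : (ev n c a).1 i j = (a.1 i j).eval c :=
  Polynomial.coe_aeval_eq_eval c ▸ rfl

/-- The residue gives f(c) - f(0), and the dual number part supplies f(0). Pairing with a test
element is thus evaluation at c, which is the content of `Q_emb_testElt`. -/
theorem res_ofPoly_mul_test (c : ℂ) (f : Polynomial ℂ) :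
    res (uL⁻¹ ^ 2 * (ofPoly f * ofPS (PowerSeries.mk fun k ↦ c ^ (k + 1)))) -
      TrivSqZeroExt.snd (Polynomial.aeval (DualNumber.eps : DualNumber ℂ) f * -DualNumber.eps) =
    f.eval c := by
  induction f using Polynomial.induction_on' with
  | add a b ha hb =>
    rw [Polynomial.eval_add, ← ha, ← hb]
    simp only [map_add, mul_add, add_mul, TrivSqZeroExt.snd_add]
    ring
  | monomial k b =>
    rw [aeval_eps_monomial, ofPoly, Polynomial.aeval_monomial, ← Algebra.smul_def,
      smul_mul_assoc, mul_smul_comm, map_smul, inv_pow, ← mul_assoc]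
    have h : (uL ^ 2)⁻¹ * uL ^ k = uL ^ ((k : ℤ) - 2) := by
      rw [zpow_sub₀ uL_ne_zero, zpow_natCast, div_eq_mul_inv, mul_comm]; norm_cast
    rw [h, res, coeffU_uL_zpow_mul_ofPS, Polynomial.eval_monomial]
    rcases k with _ | _ | k
    · simp
    · simp
    · rw [if_pos (by push_cast; omega)]
      have : (((k + 1 + 1 : ℕ) : ℤ) - 2 - -1).toNat = k + 1 := by omega
      rw [this]
      simp

theorem Q_emb_testElt (a : P n) (c : ℂ) (z : 𝔤 n) :
    Q n (emb n a) (testElt c z) = killing n (ev n c a) z := by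
  set f : Polynomial ℂ := ∑ i, ∑ j, z.1 j i • a.1 i j with hf
  have h1 : ((emb n a).1.1 * (testElt c z).1.1).trace =
      ofPoly f * ofPS (PowerSeries.mk fun k ↦ c ^ (k + 1)) := by
    simp only [hf, Matrix.trace, Matrix.diag_apply, Matrix.mul_apply, testElt_fst_apply, map_sum,
      Finset.sum_mul, map_smul, smul_mul_assoc, mul_smul_comm]
    rfl
  have h2 : ((emb n a).2.1 * (testElt c z).2.1).trace =
      Polynomial.aeval (DualNumber.eps : DualNumber ℂ) f * -DualNumber.eps := by
    simp only [hf, Matrix.trace, Matrix.diag_apply, Matrix.mul_apply, testElt_snd_apply, map_sum,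
      Finset.sum_mul, map_smul, smul_mul_assoc, mul_smul_comm]
    rfl
  rw [Q_apply, h1, h2, res_ofPoly_mul_test, killing_apply]
  congr 1
  simp only [hf, Polynomial.eval_finsetSum, Polynomial.eval_smul, Matrix.trace,
    Matrix.diag_apply, Matrix.mul_apply, ev_apply, smul_eq_mul]
  exact Finset.sum_congr rfl fun i _ ↦ Finset.sum_congr rfl fun j _ ↦ mul_comm _ _

theorem eq_zero_of_ev_eq_zero {a : P n} (s : Finset ℂ) (h : ∀ c ∉ s, ev n c a = 0) : a = 0 := by
  refine Subtype.ext (Matrix.ext fun i j ↦ ?_)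
  refine Polynomial.eq_zero_of_infinite_isRoot _ ?_
  refine (s.finite_toSet.infinite_compl).mono fun c hc ↦ ?_
  have := congrFun (congrFun (congrArg Subtype.val (h c hc)) i) j
  rw [ev_apply] at this
  exact this

/-- An element orthogonal to the graph is y + a with y in the graph and a in `P`. Pairing with the
graph of `testElt c z` leaves K(a(c), z), so a vanishes at every point. -/
theorem mem_graphSub_iff {p : P n ⊗[ℂ] P n} (hp : TensorProduct.comm ℂ (P n) (P n) p = -p)
    (x : Double n) : x ∈ graphSub p ↔ ∀ y ∈ graphSub p, Q n x y = 0 := by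
  refine ⟨fun hx y hy ↦ Q_graphSub hp hx hy, fun h ↦ ?_⟩
  obtain ⟨y, hy, a, rfl⟩ := exists_graphSub_add_emb p x
  have ha : a = 0 := by
    refine eq_zero_of_ev_eq_zero ∅ fun c _ ↦ ?_
    refine (killing_nondegenerate n).1 _ fun z ↦ ?_
    have h1 := h _ ⟨_, testElt_mem_pStar c z, rfl⟩
    rw [map_add, LinearMap.add_apply, Q_graphSub hp hy ⟨_, testElt_mem_pStar c z, rfl⟩, zero_add,
      graphMap_apply, map_add, contract_eq_emb, Q_emb_emb, add_zero, Q_emb_testElt] at h1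
    exact h1
  rwa [ha, map_zero, add_zero]

/-- Elements of `P*` are sums of test elements up to terms of arbitrarily negative degree. -/
theorem exists_sum_testElt_add {w : Double n} (hw : w ∈ pStar n) (N : ℕ) (c : Fin (N + 1) → ℂ)
    (hc : Function.Injective c) : ∃ z : Fin (N + 1) → 𝔤 n, ∃ r : Double n, r.2 = 0 ∧
      (∀ i j, r.1.1 i j ∈ bd (-N)) ∧ w = ∑ i, testElt (c i) (z i) + r := by
  obtain ⟨g, hg⟩ := hw.1
  -- The required moments ∑ cᵢᵏ zᵢ: the zeroth is fixed by the ε component, with the sign of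
  -- `testElt`, and the (k + 1)-st by the coefficient of u^(-k). The Vandermonde system is solvable
  -- since the points are distinct.
  let t : Fin (N + 1) → 𝔤 n := Fin.cons (-dualSnd n w.2)
    fun k ↦ slMap n (PowerSeries.coeff (R := ℂ) (k : ℕ)) g
  let V := Matrix.vandermonde c
  have hV : IsUnit Vᵀ.det := by
    rw [Matrix.det_transpose, isUnit_iff_ne_zero]
    exact Matrix.det_vandermonde_ne_zero_iff.2 hc
  let z : Fin (N + 1) → 𝔤 n := fun i ↦ ∑ l, (Vᵀ)⁻¹ i l • t l
  have hz : ∀ k : Fin (N + 1), ∑ i, c i ^ (k : ℕ) • z i = t k := by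
    intro k
    have h1 : ∀ i, c i ^ (k : ℕ) • z i = ∑ l, (Vᵀ k i * (Vᵀ)⁻¹ i l) • t l := fun i ↦ by
      simp only [z, Finset.smul_sum, smul_smul]
      rfl
    simp only [h1]
    rw [Finset.sum_comm]
    simp only [← Finset.sum_smul]
    have h2 : ∀ l, ∑ i, Vᵀ k i * (Vᵀ)⁻¹ i l = (1 : Matrix _ _ ℂ) k l := fun l ↦ by
      rw [← Matrix.mul_nonsing_inv _ hV, Matrix.mul_apply]
    simp only [h2, Matrix.one_apply, ite_smul, one_smul, zero_smul, Finset.sum_ite_eq,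
      Finset.mem_univ, if_true]
  have hzk : ∀ (k : Fin (N + 1)) i j, ∑ l, c l ^ (k : ℕ) * (z l).1 i j = (t k).1 i j := by
    intro k i j
    rw [← hz k]
    simp [Matrix.sum_apply]
  refine ⟨z, w - ∑ i, testElt (c i) (z i), ?_, fun i j ↦ ?_, by abel⟩
  · refine Subtype.ext (Matrix.ext fun i j ↦ ?_)
    have h1 : (w - ∑ l, testElt (c l) (z l)).2.1 i j =
        w.2.1 i j - ∑ l, (z l).1 i j • (-DualNumber.eps : DualNumber ℂ) := by
      rw [Prod.snd_sub, Prod.snd_sum, AddSubgroupClass.coe_sub, Matrix.sub_apply,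
        AddSubmonoidClass.coe_finsetSum, Matrix.sum_apply]
      rfl
    rw [h1, ← Finset.sum_smul]
    have h2 := hzk 0 i j
    simp only [Fin.val_zero, pow_zero, one_mul, t, Fin.cons_zero] at h2
    rw [h2]
    refine TrivSqZeroExt.ext ?_ ?_
    · rw [TrivSqZeroExt.fst_sub, fst_snd_of_mem_pStar hw]
      simp
    · rw [TrivSqZeroExt.snd_sub]
      change _ - -TrivSqZeroExt.snd (w.2.1 i j) * -1 = (0 : ℂ)
      ring
  · have h1 : (w - ∑ l, testElt (c l) (z l)).1.1 i j =
        ofPS (g.1 i j - ∑ l, (z l).1 i j • (PowerSeries.mk fun k ↦ c l ^ (k + 1))) := by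
      rw [Prod.fst_sub, Prod.fst_sum, AddSubgroupClass.coe_sub, Matrix.sub_apply,
        AddSubmonoidClass.coe_finsetSum, Matrix.sum_apply, map_sub, map_sum]
      congr 1
      · have : w.1.1 = g.1.map ofPS := congrArg Subtype.val hg.symm
        rw [this]; rfl
      · refine Finset.sum_congr rfl fun l _ ↦ ?_
        rw [map_smul]; rfl
    rw [h1]
    have h2 : (PowerSeries.X : PowerSeries ℂ) ^ N ∣
        g.1 i j - ∑ l, (z l).1 i j • (PowerSeries.mk fun k ↦ c l ^ (k + 1)) := by
      rw [PowerSeries.X_pow_dvd_iff]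
      intro k hk
      have h3 := hzk (Fin.succ ⟨k, hk⟩) i j
      simp only [t, Fin.cons_succ, Fin.val_succ] at h3
      rw [map_sub, map_sum]
      simp only [map_smul, PowerSeries.coeff_mk, smul_eq_mul, mul_comm]
      rw [h3]
      exact sub_self _
    obtain ⟨h, hh⟩ := h2
    refine ⟨h, ?_⟩
    rw [hh, map_mul, map_pow, ofPS_X, _root_.zpow_neg, zpow_natCast, inv_pow]

/-! ### The action of `ℂ[u]` on the double -/

/-- Multiplication by a polynomial on the double. -/
def act (f : Polynomial ℂ) (y : Double n) : Double n :=
  (ofPoly f • y.1, Polynomial.aeval (DualNumber.eps : DualNumber ℂ) f • y.2)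

theorem act_mul (f g : Polynomial ℂ) (y : Double n) : act (f * g) y = act f (act g y) := by
  simp [act, mul_smul]

theorem act_add (f : Polynomial ℂ) (x y : Double n) : act f (x + y) = act f x + act f y := by
  simp [act, smul_add]

theorem act_neg (f : Polynomial ℂ) (x : Double n) : act f (-x) = -act f x := by
  simp [act, smul_neg]

theorem act_emb (f : Polynomial ℂ) (a : P n) : act f (emb n a) = emb n (f • a) :=
  Prod.ext (Subtype.ext (Matrix.ext fun _ _ ↦ (map_mul ofPoly _ _).symm))
    (Subtype.ext (Matrix.ext fun _ _ ↦
      (map_mul (Polynomial.aeval (DualNumber.eps : DualNumber ℂ)) _ _).symm))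

theorem act_lie (f g : Polynomial ℂ) (x y : Double n) :
    act (f * g) ⁅x, y⁆ = ⁅act f x, act g y⁆ := by
  have h : ∀ {A : Type} [CommRing A] (a b : A) (x y : Matrix (Fin n) (Fin n) A),
      (a * b) • (x * y - y * x) = (a • x) * (b • y) - (b • y) * (a • x) := by
    intro A _ a b x y
    rw [smul_mul_smul_comm, smul_mul_smul_comm, mul_comm b a, smul_sub]
  refine Prod.ext (Subtype.ext ?_) (Subtype.ext ?_)
  · change ofPoly (f * g) • (x.1.1 * y.1.1 - y.1.1 * x.1.1) = _
    rw [map_mul, h]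
    rfl
  · change Polynomial.aeval (DualNumber.eps : DualNumber ℂ) (f * g) •
      (x.2.1 * y.2.1 - y.2.1 * x.2.1) = _
    rw [map_mul, h]
    rfl

/-- On the second component u acts as ε, and ε - c is a unit only for c ≠ 0. This is why brackets
are computed at nonzero points. -/
theorem act_X_sub_C_injective {c : ℂ} (hc : c ≠ 0) :
    Function.Injective (act (n := n) (Polynomial.X - Polynomial.C c)) := by
  intro x y h
  have h1 : ofPoly (Polynomial.X - Polynomial.C c) ≠ 0 := fun h ↦
    Polynomial.X_sub_C_ne_zero c (ofPoly_injective (by rw [h, map_zero]))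
  have h2 : IsUnit (Polynomial.aeval (DualNumber.eps : DualNumber ℂ)
      (Polynomial.X - Polynomial.C c)) := by
    rw [TrivSqZeroExt.isUnit_iff_isUnit_fst]
    simpa [TrivSqZeroExt.algebraMap_eq_inl] using hc
  refine Prod.ext ?_ ?_
  · exact smul_right_injective _ h1 (congrArg Prod.fst h)
  · exact h2.smul_left_cancel.1 (congrArg Prod.snd h)

/-! ### Contractions with the `r`-matrix -/

/-- `(K(z, ·) ⊗ id) t`. -/
def contractFst (z : 𝔤 n) : 𝔤 n ⊗[ℂ] 𝔤 n →ₗ[ℂ] 𝔤 n :=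
  (TensorProduct.lid ℂ (𝔤 n)).toLinearMap ∘ₗ TensorProduct.map (killing n z) LinearMap.id

/-- `(id ⊗ K(z, ·)) t`. -/
def contractSnd (z : 𝔤 n) : 𝔤 n ⊗[ℂ] 𝔤 n →ₗ[ℂ] 𝔤 n :=
  (TensorProduct.rid ℂ (𝔤 n)).toLinearMap ∘ₗ TensorProduct.map LinearMap.id (killing n z)

/-- `(K(z, ·) ⊗ id) p(c, u)`. -/
def contractPoly (c : ℂ) (z : 𝔤 n) : P n ⊗[ℂ] P n →ₗ[ℂ] P n :=
  (TensorProduct.lid ℂ (P n)).toLinearMap ∘ₗ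
    TensorProduct.map (killing n z ∘ₗ ev n c) LinearMap.id

@[simp] theorem contractFst_tmul (z a b : 𝔤 n) :
    contractFst z (a ⊗ₜ b) = killing n z a • b := by simp [contractFst]

@[simp] theorem contractSnd_tmul (z a b : 𝔤 n) :
    contractSnd z (a ⊗ₜ b) = killing n z b • a := by simp [contractSnd]

@[simp] theorem contractPoly_tmul (c : ℂ) (z : 𝔤 n) (a b : P n) :
    contractPoly c z (a ⊗ₜ b) = killing n z (ev n c a) • b := by simp [contractPoly]

theorem contract_testElt (c : ℂ) (z : 𝔤 n) (p : P n ⊗[ℂ] P n) :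
    contract (testElt c z) p = emb n (contractPoly c z p) := by
  induction p with
  | zero => simp [contract]
  | tmul a b => rw [contract_tmul, contractPoly_tmul, map_smul, Q_comm, Q_emb_testElt, killing_comm]
  | add p q hp hq => rw [contract_add, map_add, map_add, hp, hq]

theorem ev_contractPoly (c d : ℂ) (z : 𝔤 n) (p : P n ⊗[ℂ] P n) :
    ev n d (contractPoly c z p) = contractFst z (TensorProduct.map (ev n c) (ev n d) p) := by
  induction p with
  | zero => simp
  | tmul a b => simp
  | add p q hp hq => simp only [map_add, hp, hq]

theorem contractFst_Ω (z : 𝔤 n) : contractFst z (Ω n) = z := by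
  rw [Ω, map_sum]
  simp only [contractFst_tmul]
  let b := Module.finBasis ℂ (𝔤 n)
  let b' := (killing n).dualBasis (killing_nondegenerate n) b
  have h1 : ∀ i, killing n z (b i) = b'.repr z i := fun i ↦ by
    rw [killing_comm]
    conv_lhs => rw [← b'.sum_repr z]
    rw [map_sum, Finset.sum_eq_single i]
    · rw [map_smul, killing_comm, LinearMap.BilinForm.apply_dualBasis_left]
      simp
    · intro j _ hj
      rw [map_smul, killing_comm, LinearMap.BilinForm.apply_dualBasis_left]
      simp [Ne.symm hj]
    · simp
  change ∑ i, killing n z (b i) • b' i = z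
  simp only [h1]
  exact b'.sum_repr z

/-- The polynomial `(u - c) (K(z, ·) ⊗ id) q(c, u)`. -/
def numer (p : P n ⊗[ℂ] P n) (c : ℂ) (z : 𝔤 n) : P n :=
  (Polynomial.C c * Polynomial.X) • slMap n (Algebra.linearMap ℂ (Polynomial ℂ)) z +
    (Polynomial.X - Polynomial.C c) • contractPoly c z p

theorem ev_smul (d : ℂ) (f : Polynomial ℂ) (a : P n) : ev n d (f • a) = f.eval d • ev n d a := by
  refine Subtype.ext (Matrix.ext fun i j ↦ ?_)
  change _ = f.eval d * (ev n d a).1 i j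
  rw [ev_apply, ev_apply]
  exact Polynomial.eval_mul

theorem ev_lie (d : ℂ) (a b : P n) : ev n d ⁅a, b⁆ = ⁅ev n d a, ev n d b⁆ := by
  refine Subtype.ext ?_
  let φ := Polynomial.aeval (R := ℂ) d
  change (a.1 * b.1 - b.1 * a.1).map φ = a.1.map φ * b.1.map φ - b.1.map φ * a.1.map φ
  rw [Matrix.map_sub _ (map_sub _), Matrix.map_mul, Matrix.map_mul]

theorem ev_numer (p : P n ⊗[ℂ] P n) {c d : ℂ} (hcd : c ≠ d) (z : 𝔤 n) :
    ev n d (numer p c z) = (d - c) • contractFst z (rFun p c d) := by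
  have h1 : ev n d (slMap n (Algebra.linearMap ℂ (Polynomial ℂ)) z) = z := by
    refine Subtype.ext (Matrix.ext fun i j ↦ ?_)
    rw [ev_apply]
    exact Polynomial.eval_C
  have h2 : d - c ≠ 0 := sub_ne_zero.2 hcd.symm
  rw [numer, map_add, ev_smul, ev_smul, h1, rFun, map_add, map_smul, contractFst_Ω,
    ev_contractPoly, smul_add, smul_smul, mul_div_cancel₀ _ h2]
  simp

/-- Clearing the denominator u - c turns an element of the graph into a polynomial, so that
identities between such elements can be checked by evaluation at points. The test element itself
contributes c u z, because (u - c) · c u z/(u - c) = c u z at infinity and (ε - c)(-z ε) = c z ε as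
ε² = 0. -/
theorem act_graphMap_testElt (p : P n ⊗[ℂ] P n) (c : ℂ) (z : 𝔤 n) :
    act (Polynomial.X - Polynomial.C c) (graphMap p (testElt c z)) = emb n (numer p c z) := by
  rw [graphMap_apply, act_add, contract_testElt, act_emb, numer, map_add]
  congr 1
  have hX : ofPoly Polynomial.X = uL := Polynomial.aeval_X _
  have hC : ∀ c, ofPoly (Polynomial.C c) = algebraMap ℂ Laur c := Polynomial.aeval_C _
  refine Prod.ext (Subtype.ext (Matrix.ext fun i j ↦ ?_)) (Subtype.ext (Matrix.ext fun i j ↦ ?_))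
  · change ofPoly (Polynomial.X - Polynomial.C c) *
        (z.1 i j • ofPS (PowerSeries.mk fun k ↦ c ^ (k + 1))) =
      ofPoly (Polynomial.C c * Polynomial.X * Polynomial.C (z.1 i j))
    have h1 : (1 - PowerSeries.C c * PowerSeries.X) * (PowerSeries.mk fun k ↦ c ^ (k + 1)) =
        PowerSeries.C c := by
      ext k
      rw [sub_mul, one_mul, mul_assoc, map_sub, PowerSeries.coeff_C_mul]
      rcases k with _ | k
      · simp
      · rw [PowerSeries.coeff_succ_X_mul, PowerSeries.coeff_mk, PowerSeries.coeff_mk,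
          PowerSeries.coeff_C, if_neg (Nat.succ_ne_zero k)]
        ring
    have h2 := congrArg ofPS h1
    have hCo : ofPS (PowerSeries.C c) = algebraMap ℂ Laur c := ofPS.commutes c
    rw [map_mul, map_sub, map_one, map_mul, ofPS_X, hCo] at h2
    rw [map_sub, map_mul, map_mul, hX, hC, hC, Algebra.smul_def]
    have h3 : uL - algebraMap ℂ Laur c = uL * (1 - algebraMap ℂ Laur c * uL⁻¹) := by
      have := uL_ne_zero
      field_simp
    rw [h3]
    linear_combination (uL * algebraMap ℂ Laur (z.1 i j)) * h2
  · change Polynomial.aeval (DualNumber.eps : DualNumber ℂ) (Polynomial.X - Polynomial.C c) *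
        (z.1 i j • (-DualNumber.eps : DualNumber ℂ)) =
      Polynomial.aeval (DualNumber.eps : DualNumber ℂ)
        (Polynomial.C c * Polynomial.X * Polynomial.C (z.1 i j))
    simp only [map_sub, map_mul, Polynomial.aeval_X, Polynomial.aeval_C, Algebra.smul_def]
    linear_combination (-algebraMap ℂ (DualNumber ℂ) (z.1 i j)) *
      (DualNumber.eps_mul_eps (R := ℂ))

/-! ### The Yang-Baxter equation and the Lie bracket -/

/-- `(K(z, ·) ⊗ K(w, ·) ⊗ id) t`. -/
def contractTwo (z w : 𝔤 n) : 𝔤 n ⊗[ℂ] (𝔤 n ⊗[ℂ] 𝔤 n) →ₗ[ℂ] 𝔤 n :=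
  (TensorProduct.lid ℂ (𝔤 n)).toLinearMap ∘ₗ TensorProduct.map (killing n z) (contractFst w)

@[simp] theorem contractTwo_tmul (z w a b c : 𝔤 n) :
    contractTwo z w (a ⊗ₜ (b ⊗ₜ c)) = killing n z a • killing n w b • c := by
  simp [contractTwo, smul_comm (killing n w b)]

/-- This term of the Yang–Baxter equation becomes the bracket of two contracted r-matrices. By
invariance of K, the other two terms become single contractions with modified arguments. -/
theorem contractTwo_br₁₃₂₃ (z w : 𝔤 n) (x y : 𝔤 n ⊗[ℂ] 𝔤 n) :
    contractTwo z w (br₁₃₂₃ x y) = ⁅contractFst z x, contractFst w y⁆ := by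
  have hx : ∀ x x' y : 𝔤 n ⊗[ℂ] 𝔤 n, br₁₃₂₃ (x + x') y = br₁₃₂₃ x y + br₁₃₂₃ x' y :=
    fun x x' y ↦ by simp [br₁₃₂₃]
  have hy : ∀ x y y' : 𝔤 n ⊗[ℂ] 𝔤 n, br₁₃₂₃ x (y + y') = br₁₃₂₃ x y + br₁₃₂₃ x y' :=
    fun x y y' ↦ by simp [br₁₃₂₃]
  induction x with
  | zero => simp [br₁₃₂₃]
  | add x x' h h' => rw [hx, map_add, h, h', map_add, add_lie]
  | tmul a b =>
    induction y with
    | zero => simp [br₁₃₂₃]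
    | add y y' h h' => rw [hy, map_add, h, h', map_add, lie_add]
    | tmul c d => simp [br₁₃₂₃_tmul, smul_comm (killing n z a)]

theorem contractTwo_br₁₂₁₃ (z w : 𝔤 n) (x y : 𝔤 n ⊗[ℂ] 𝔤 n) :
    contractTwo z w (br₁₂₁₃ x y) = contractFst ⁅z, contractSnd w x⁆ y := by
  have hx : ∀ x x' y : 𝔤 n ⊗[ℂ] 𝔤 n, br₁₂₁₃ (x + x') y = br₁₂₁₃ x y + br₁₂₁₃ x' y :=
    fun x x' y ↦ by simp [br₁₂₁₃]
  have hy : ∀ x y y' : 𝔤 n ⊗[ℂ] 𝔤 n, br₁₂₁₃ x (y + y') = br₁₂₁₃ x y + br₁₂₁₃ x y' :=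
    fun x y y' ↦ by simp [br₁₂₁₃]
  have hadd : ∀ z z' : 𝔤 n, ∀ y : 𝔤 n ⊗[ℂ] 𝔤 n,
      contractFst (z + z') y = contractFst z y + contractFst z' y := fun z z' y ↦ by
    simp [contractFst, TensorProduct.map_add_left]
  induction x with
  | zero => simp [br₁₂₁₃, contractFst]
  | add x x' h h' => rw [hx, map_add, h, h', map_add, lie_add, hadd]
  | tmul a b =>
    induction y with
    | zero => simp [br₁₂₁₃]
    | add y y' h h' => rw [hy, map_add, h, h', map_add]
    | tmul c d =>
      rw [br₁₂₁₃_tmul, contractTwo_tmul, contractSnd_tmul, contractFst_tmul, lie_smul, map_smul,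
        LinearMap.smul_apply, killing_lie, smul_smul, smul_eq_mul, mul_comm]

theorem contractTwo_br₁₂₂₃ (z w : 𝔤 n) (x y : 𝔤 n ⊗[ℂ] 𝔤 n) :
    contractTwo z w (br₁₂₂₃ x y) = contractFst ⁅w, contractFst z x⁆ y := by
  have hx : ∀ x x' y : 𝔤 n ⊗[ℂ] 𝔤 n, br₁₂₂₃ (x + x') y = br₁₂₂₃ x y + br₁₂₂₃ x' y :=
    fun x x' y ↦ by simp [br₁₂₂₃]
  have hy : ∀ x y y' : 𝔤 n ⊗[ℂ] 𝔤 n, br₁₂₂₃ x (y + y') = br₁₂₂₃ x y + br₁₂₂₃ x y' :=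
    fun x y y' ↦ by simp [br₁₂₂₃]
  have hadd : ∀ z z' : 𝔤 n, ∀ y : 𝔤 n ⊗[ℂ] 𝔤 n,
      contractFst (z + z') y = contractFst z y + contractFst z' y := fun z z' y ↦ by
    simp [contractFst, TensorProduct.map_add_left]
  induction x with
  | zero => simp [br₁₂₂₃, contractFst]
  | add x x' h h' => rw [hx, map_add, h, h', map_add, lie_add, hadd]
  | tmul a b =>
    induction y with
    | zero => simp [br₁₂₂₃]
    | add y y' h h' => rw [hy, map_add, h, h', map_add]
    | tmul c d =>
      rw [br₁₂₂₃_tmul, contractTwo_tmul, contractFst_tmul, contractFst_tmul, lie_smul, map_smul,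
        LinearMap.smul_apply, killing_lie, smul_smul, smul_eq_mul]

/-- Contracting the Yang–Baxter equation at (c, d, u) with z and w gives, as functions of u, the
bracket in terms of contractions of q(c, u) and q(d, u) with the elements z' and w' defined below.
These are again graphs of test elements. -/
theorem lie_graphMap_testElt {p : P n ⊗[ℂ] P n} (hp : CYBE (rFun p)) {c d : ℂ} (hc : c ≠ 0)
    (hd : d ≠ 0) (hcd : c ≠ d) (z w : 𝔤 n) :
    ⁅graphMap p (testElt c z), graphMap p (testElt d w)⁆ ∈ graphSub p := by
  set z' := ⁅z, contractSnd w (rFun p c d)⁆ with hz'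
  set w' := ⁅w, contractFst z (rFun p c d)⁆ with hw'
  -- The identity multiplied by (u - c)(u - d): it is polynomial in u, so checking it away from c
  -- and d suffices.
  have hpoly : ⁅numer p c z, numer p d w⁆ = -((Polynomial.X - Polynomial.C d) • numer p c z' +
      (Polynomial.X - Polynomial.C c) • numer p d w') := by
    rw [← sub_eq_zero]
    refine eq_zero_of_ev_eq_zero {c, d} fun u hu ↦ ?_
    have huc : c ≠ u := fun h ↦ hu (by simp [h])
    have hud : d ≠ u := fun h ↦ hu (by simp [h])
    have h1 := congrArg (contractTwo z w) (hp c d u hcd huc hud)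
    rw [map_add, map_add, contractTwo_br₁₂₁₃, contractTwo_br₁₂₂₃, contractTwo_br₁₃₂₃,
      map_zero] at h1
    rw [map_sub, ev_lie, map_neg, map_add, ev_smul, ev_smul, ev_numer _ huc, ev_numer _ hud,
      ev_numer _ huc, ev_numer _ hud, smul_lie, lie_smul, sub_neg_eq_add]
    simp only [Polynomial.eval_sub, Polynomial.eval_X, Polynomial.eval_C, smul_smul]
    rw [mul_comm (u - d), ← smul_add, ← smul_add, add_comm ⁅_, _⁆, h1, smul_zero]
  have hlie : ⁅graphMap p (testElt c z), graphMap p (testElt d w)⁆ =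
      -(graphMap p (testElt c z') + graphMap p (testElt d w')) := by
    apply act_X_sub_C_injective hc
    apply act_X_sub_C_injective hd
    rw [← act_mul, ← act_mul, mul_comm, act_lie, act_graphMap_testElt, act_graphMap_testElt,
      ← emb_lie, hpoly, act_neg, act_add, map_neg, map_add, ← act_emb, ← act_emb,
      ← act_graphMap_testElt, ← act_graphMap_testElt, ← act_mul, ← act_mul,
      mul_comm (Polynomial.X - Polynomial.C d)]
  rw [hlie, ← map_add]
  exact neg_mem ⟨_, add_mem (testElt_mem_pStar _ _) (testElt_mem_pStar _ _), rfl⟩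

theorem lie_fst_mem_bd {M : ℤ} {x y : Double n} (hx : ∀ i j, x.1.1 i j ∈ bd M)
    (hy : ∀ i j, y.1.1 i j ∈ bd M) (i j : Fin n) : ⁅x, y⁆.1.1 i j ∈ bd (M + M) := by
  change (x.1.1 * y.1.1 - y.1.1 * x.1.1) i j ∈ bd (M + M)
  rw [Matrix.sub_apply, Matrix.mul_apply, Matrix.mul_apply]
  exact sub_mem (sum_mem fun k _ ↦ mul_mem_bd (hx i k) (hy k j))
    (sum_mem fun k _ ↦ mul_mem_bd (hy i k) (hx k j))

theorem graphMap_eq_self {p : P n ⊗[ℂ] P n} {w : Double n} (h : contract w p = 0) :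
    graphMap p w = w := by
  rw [graphMap_apply, h, add_zero]

/-- As the graph is its own orthogonal complement, it is enough that the bracket is orthogonal to
each v. For this, x and y may be replaced by finite sums of graphs of test elements. -/
theorem lie_mem_graphSub {p : P n ⊗[ℂ] P n} (hskew : TensorProduct.comm ℂ (P n) (P n) p = -p)
    (hp : CYBE (rFun p)) {x y : Double n} (hx : x ∈ graphSub p) (hy : y ∈ graphSub p) :
    ⁅x, y⁆ ∈ graphSub p := by
  rw [mem_graphSub_iff hskew]
  intro v hv
  obtain ⟨M, hM⟩ := exists_graphSub_mem_bd p
  obtain ⟨N₀, hN₀⟩ := exists_contract_eq_zero p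
  -- N ≥ N₀ makes the remainder r equal to its own graph. N ≥ 2M makes it orthogonal to brackets of
  -- graph elements, which have degree at most 2M.
  set N := N₀ + 2 * M with hN
  have key : ∀ (c : Fin (N + 1) → ℂ), Function.Injective c → ∀ w ∈ pStar n,
      ∃ z : Fin (N + 1) → 𝔤 n, ∃ r : Double n, r.2 = 0 ∧ (∀ i j, r.1.1 i j ∈ bd (-N)) ∧
        graphMap p w = ∑ i, graphMap p (testElt (c i) (z i)) + r := by
    intro c hc w hw
    obtain ⟨z, r, hr2, hr1, hw'⟩ := exists_sum_testElt_add hw N c hc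
    refine ⟨z, r, hr2, hr1, ?_⟩
    rw [hw', map_add, map_sum, graphMap_eq_self (hN₀ r hr2 fun i j ↦
      bd_mono (by push_cast [hN]; omega) (hr1 i j))]
  have hmem : ∀ {m : ℕ} (c : Fin m → ℂ) (z : Fin m → 𝔤 n),
      ∑ i, graphMap p (testElt (c i) (z i)) ∈ graphSub p := fun c z ↦
    sum_mem fun i _ ↦ ⟨_, testElt_mem_pStar _ _, rfl⟩
  have hQ : ∀ r : Double n, r.2 = 0 → (∀ i j, r.1.1 i j ∈ bd (-N)) → ∀ x ∈ graphSub p,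
      ∀ y ∈ graphSub p, Q n r ⁅x, y⁆ = 0 := fun r hr2 hr1 x hx y hy ↦
    Q_eq_zero_of_mem_bd (by push_cast [hN]; omega) hr2 hr1 (lie_fst_mem_bd (hM x hx) (hM y hy))
  obtain ⟨w₁, hw₁, rfl⟩ := hx
  obtain ⟨w₂, hw₂, rfl⟩ := id hy
  -- Positive points for x and negative ones for y: all are nonzero and no c equals a d, as
  -- `lie_graphMap_testElt` requires.
  let c : Fin (N + 1) → ℂ := fun i ↦ ((i : ℕ) : ℂ) + 1
  let d : Fin (N + 1) → ℂ := fun i ↦ -(((i : ℕ) : ℂ) + 1)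
  have hc : Function.Injective c := fun i j h ↦ by
    simpa [c, Fin.ext_iff] using h
  have hd : Function.Injective d := fun i j h ↦ by
    simpa [d, Fin.ext_iff] using h
  obtain ⟨z, r, hr2, hr1, hz⟩ := key c hc w₁ hw₁
  obtain ⟨z', r', hr2', hr1', hz'⟩ := key d hd w₂ hw₂
  have e1 : Q n ⁅graphMap p w₁, graphMap p w₂⁆ v =
      Q n ⁅∑ i, graphMap p (testElt (c i) (z i)), graphMap p w₂⁆ v := by
    conv_lhs => rw [hz, add_lie, map_add, LinearMap.add_apply, Q_lie r, hQ r hr2 hr1 _ hy _ hv,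
      add_zero]
  have e2 : Q n ⁅∑ i, graphMap p (testElt (c i) (z i)), graphMap p w₂⁆ v =
      Q n ⁅∑ i, graphMap p (testElt (c i) (z i)), ∑ i, graphMap p (testElt (d i) (z' i))⁆ v := by
    have h1 : Q n ⁅∑ i, graphMap p (testElt (c i) (z i)), r'⁆ v = 0 := by
      rw [← lie_skew, map_neg, LinearMap.neg_apply, Q_lie, hQ r' hr2' hr1' _ (hmem c z) _ hv,
        neg_zero]
    rw [hz', lie_add, map_add, LinearMap.add_apply, h1, add_zero]
  rw [e1, e2]
  refine Q_graphSub hskew ?_ hv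
  rw [sum_lie_sum]
  refine sum_mem fun i _ ↦ sum_mem fun j _ ↦ lie_graphMap_testElt hp ?_ ?_ ?_ _ _
  · exact Nat.cast_add_one_ne_zero _
  · exact neg_ne_zero.2 (Nat.cast_add_one_ne_zero _)
  · intro h
    have h2 : ((i : ℕ) + 1 + ((j : ℕ) + 1) : ℂ) = 0 := by
      have h3 : ((i : ℕ) : ℂ) + 1 = -(((j : ℕ) : ℂ) + 1) := h
      rw [h3]; ring
    have h4 : ((i : ℕ) + 1 + ((j : ℕ) + 1) : ℕ) ≠ 0 := by omega
    exact h4 (by exact_mod_cast h2)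

/-- The Lie subalgebra of the double that corresponds to a quasi-rational `r`-matrix. -/
def correspondingSubalgebra (q : QuasiRationalRMatrix n) : LieSubalgebra ℂ (Double n) where
  __ := graphSub q.poly
  lie_mem' := lie_mem_graphSub q.skew q.cybe

theorem isLagrangian_correspondingSubalgebra (q : QuasiRationalRMatrix n) :
    IsLagrangian (correspondingSubalgebra q) := mem_graphSub_iff q.skew

theorem corresponds_correspondingSubalgebra (q : QuasiRationalRMatrix n) :
    Corresponds (correspondingSubalgebra q) q := by
  ext x
  constructor
  · rintro ⟨w, hw, rfl⟩
    exact ⟨w, hw, rfl⟩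
  · rintro ⟨w, hw, rfl⟩
    exact ⟨w, hw, rfl⟩

/-! ### The adjoint action and the Casimir element -/

theorem Ad_val (g : Matrix.SpecialLinearGroup (Fin n) ℂ) (x : 𝔤 n) :
    (Ad g x).1 = g.1 * x.1 * (g⁻¹).1 := rfl

theorem specialLinear_inv_mul {R : Type*} [CommRing R]
    (g : Matrix.SpecialLinearGroup (Fin n) R) : (g⁻¹).1 * g.1 = 1 :=
  congrArg Subtype.val (inv_mul_cancel g)

theorem Ad_inv_Ad (g : Matrix.SpecialLinearGroup (Fin n) ℂ) (x : 𝔤 n) : Ad g⁻¹ (Ad g x) = x := by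
  refine Subtype.ext ?_
  rw [Ad_val, Ad_val, inv_inv]
  calc (g⁻¹).1 * (g.1 * x.1 * (g⁻¹).1) * g.1 = ((g⁻¹).1 * g.1) * x.1 * ((g⁻¹).1 * g.1) := by
        simp only [Matrix.mul_assoc]
    _ = x.1 := by rw [specialLinear_inv_mul, Matrix.one_mul, Matrix.mul_one]

theorem Ad_Ad_inv (g : Matrix.SpecialLinearGroup (Fin n) ℂ) (x : 𝔤 n) : Ad g (Ad g⁻¹ x) = x := by
  have := Ad_inv_Ad g⁻¹ x
  rwa [inv_inv] at this

theorem Ad_lie (g : Matrix.SpecialLinearGroup (Fin n) ℂ) (x y : 𝔤 n) :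
    Ad g ⁅x, y⁆ = ⁅Ad g x, Ad g y⁆ := by
  have h : ∀ a b : Matrix (Fin n) (Fin n) ℂ,
      g.1 * a * (g⁻¹).1 * (g.1 * b * (g⁻¹).1) = g.1 * (a * b) * (g⁻¹).1 := fun a b ↦ by
    calc g.1 * a * (g⁻¹).1 * (g.1 * b * (g⁻¹).1)
        = g.1 * a * ((g⁻¹).1 * g.1) * b * (g⁻¹).1 := by simp only [Matrix.mul_assoc]
      _ = _ := by rw [specialLinear_inv_mul, Matrix.mul_one]; simp only [Matrix.mul_assoc]
  refine Subtype.ext ?_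
  change g.1 * (x.1 * y.1 - y.1 * x.1) * (g⁻¹).1 =
    g.1 * x.1 * (g⁻¹).1 * (g.1 * y.1 * (g⁻¹).1) - g.1 * y.1 * (g⁻¹).1 * (g.1 * x.1 * (g⁻¹).1)
  rw [h, h, Matrix.mul_sub, Matrix.sub_mul]

theorem killing_Ad (g : Matrix.SpecialLinearGroup (Fin n) ℂ) (x y : 𝔤 n) :
    killing n x (Ad g y) = killing n (Ad g⁻¹ x) y := by
  rw [killing_apply, killing_apply, Ad_val, Ad_val, inv_inv, ← Matrix.mul_assoc,
    Matrix.trace_mul_comm, ← Matrix.mul_assoc, ← Matrix.mul_assoc]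

theorem contractFst_map_Ad (g : Matrix.SpecialLinearGroup (Fin n) ℂ) (B : 𝔤 n →ₗ[ℂ] 𝔤 n)
    (z : 𝔤 n) (t : 𝔤 n ⊗[ℂ] 𝔤 n) :
    contractFst z (TensorProduct.map (Ad g) B t) = B (contractFst (Ad g⁻¹ z) t) := by
  induction t with
  | zero => simp
  | tmul a b => simp [killing_Ad]
  | add s t hs ht => simp only [map_add, hs, ht]

/-- Contracting with the dual basis recovers the tensor as ∑ bᵢ ⊗ (K(bᵢ', ·) ⊗ id) t. -/
theorem eq_of_contractFst_eq {s t : 𝔤 n ⊗[ℂ] 𝔤 n} (h : ∀ z, contractFst z s = contractFst z t) :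
    s = t := by
  let b := Module.finBasis ℂ (𝔤 n)
  let b' := (killing n).dualBasis (killing_nondegenerate n) b
  have hb : ∀ (i) (a : 𝔤 n), killing n (b' i) a = b.repr a i := fun i a ↦ by
    conv_lhs => rw [← b.sum_repr a]
    rw [map_sum, Finset.sum_eq_single i]
    · rw [map_smul, LinearMap.BilinForm.apply_dualBasis_left]
      simp
    · intro j _ hj
      rw [map_smul, LinearMap.BilinForm.apply_dualBasis_left]
      simp [hj]
    · simp
  have key : ∀ t : 𝔤 n ⊗[ℂ] 𝔤 n, t = ∑ i, b i ⊗ₜ[ℂ] contractFst (b' i) t := by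
    intro t
    induction t with
    | zero => simp
    | tmul a y =>
      simp only [contractFst_tmul, hb, TensorProduct.tmul_smul]
      conv_lhs => rw [← b.sum_repr a, TensorProduct.sum_tmul]
      rfl
    | add s t hs ht =>
      simp only [map_add, TensorProduct.tmul_add, Finset.sum_add_distrib, ← hs, ← ht]
  rw [key s, key t]
  simp only [h]

theorem map_Ad_Ω (g : Matrix.SpecialLinearGroup (Fin n) ℂ) :
    TensorProduct.map (Ad g) (Ad g) (Ω n) = Ω n :=
  eq_of_contractFst_eq fun z ↦ by
    rw [contractFst_map_Ad, contractFst_Ω, contractFst_Ω, Ad_Ad_inv]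

theorem comm_Ω : TensorProduct.comm ℂ (𝔤 n) (𝔤 n) (Ω n) = Ω n := by
  refine eq_of_contractFst_eq fun z ↦ ?_
  rw [contractFst_Ω, Ω, map_sum, map_sum]
  simp only [TensorProduct.comm_tmul, contractFst_tmul]
  let b := Module.finBasis ℂ (𝔤 n)
  let b' := (killing n).dualBasis (killing_nondegenerate n) b
  have hb : ∀ i, killing n z (b' i) = b.repr z i := fun i ↦ by
    rw [killing_comm]
    conv_lhs => rw [← b.sum_repr z]
    rw [map_sum, Finset.sum_eq_single i]
    · rw [map_smul, LinearMap.BilinForm.apply_dualBasis_left]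
      simp
    · intro j _ hj
      rw [map_smul, LinearMap.BilinForm.apply_dualBasis_left]
      simp [hj]
    · simp
  change ∑ i, killing n z (b' i) • b i = z
  simp only [hb]
  exact b.sum_repr z

/-! ### Polynomial tensors -/

/-- The evaluation of `p(u, v)`. -/
def evTwo (u v : ℂ) : P n ⊗[ℂ] P n →ₗ[ℂ] 𝔤 n ⊗[ℂ] 𝔤 n := TensorProduct.map (ev n u) (ev n v)

@[simp] theorem evTwo_tmul (u v : ℂ) (a b : P n) : evTwo u v (a ⊗ₜ b) = ev n u a ⊗ₜ ev n v b := rfl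

theorem rFun_eq (p : P n ⊗[ℂ] P n) (u v : ℂ) :
    rFun p u v = (u * v / (v - u)) • Ω n + evTwo u v p := rfl

theorem comm_evTwo (u v : ℂ) (p : P n ⊗[ℂ] P n) :
    TensorProduct.comm ℂ (𝔤 n) (𝔤 n) (evTwo u v p) =
      evTwo v u (TensorProduct.comm ℂ (P n) (P n) p) := by
  induction p with
  | zero => simp
  | tmul a b => simp
  | add s t hs ht => simp only [map_add, hs, ht]

theorem comm_map (A B : 𝔤 n →ₗ[ℂ] 𝔤 n) (t : 𝔤 n ⊗[ℂ] 𝔤 n) :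
    TensorProduct.comm ℂ (𝔤 n) (𝔤 n) (TensorProduct.map A B t) =
      TensorProduct.map B A (TensorProduct.comm ℂ (𝔤 n) (𝔤 n) t) := by
  induction t with
  | zero => simp
  | tmul a b => simp
  | add s t hs ht => simp only [map_add, hs, ht]

/-- Constants as polynomials. -/
def constP (n : ℕ) : 𝔤 n →ₗ[ℂ] P n := slMap n (Algebra.linearMap ℂ (Polynomial ℂ))

theorem ev_constP (c : ℂ) (z : 𝔤 n) : ev n c (constP n z) = z := by
  refine Subtype.ext (Matrix.ext fun i j ↦ ?_)
  rw [ev_apply]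
  exact Polynomial.eval_C

theorem exists_eq_sum_constP (b : P n) :
    ∃ N : ℕ, ∃ z : ℕ → 𝔤 n, b = ∑ k ∈ Finset.range N,
      ((Polynomial.X : Polynomial ℂ) ^ k) • constP n (z k) := by
  refine ⟨∑ i, ∑ j, ((b.1 i j).natDegree + 1),
    fun k ↦ slMap n (Polynomial.lcoeff ℂ k) b, ?_⟩
  refine Subtype.ext (Matrix.ext fun i j ↦ ?_)
  rw [AddSubmonoidClass.coe_finsetSum, Matrix.sum_apply]
  have h1 : (b.1 i j).natDegree < ∑ i, ∑ j, ((b.1 i j).natDegree + 1) := by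
    have h2 := Finset.single_le_sum (f := fun j ↦ (b.1 i j).natDegree + 1)
      (fun _ _ ↦ Nat.zero_le _) (Finset.mem_univ j)
    have h3 := Finset.single_le_sum (f := fun i ↦ ∑ j, ((b.1 i j).natDegree + 1))
      (fun _ _ ↦ Nat.zero_le _) (Finset.mem_univ i)
    exact (Nat.lt_succ_self _).trans_le (h2.trans h3)
  refine ((b.1 i j).as_sum_range' _ h1).trans (Finset.sum_congr rfl fun k _ ↦ ?_)
  rw [← Polynomial.C_mul_X_pow_eq_monomial, mul_comm]
  rfl

/-- The difference r(u, v) - r(u, u) is divisible by v - u, by the geometric sum for vᵏ - uᵏ. -/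
theorem exists_evTwo_eq (r : P n ⊗[ℂ] P n) :
    ∃ s : P n ⊗[ℂ] P n, ∀ u v : ℂ, evTwo u v r = (v - u) • evTwo u v s + evTwo u u r := by
  induction r with
  | zero => exact ⟨0, by simp⟩
  | add r r' hr hr' =>
    obtain ⟨s, hs⟩ := hr
    obtain ⟨s', hs'⟩ := hr'
    refine ⟨s + s', fun u v ↦ ?_⟩
    rw [map_add, hs, hs', map_add, map_add, smul_add]
    abel
  | tmul a b =>
    obtain ⟨N, z, rfl⟩ := exists_eq_sum_constP b
    refine ⟨∑ k ∈ Finset.range N, ∑ i ∈ Finset.range k,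
      ((Polynomial.X : Polynomial ℂ) ^ (k - 1 - i) • a) ⊗ₜ[ℂ]
        ((Polynomial.X : Polynomial ℂ) ^ i • constP n (z k)), fun u v ↦ ?_⟩
    have h1 : ∀ k i, (v - u) • evTwo u v (((Polynomial.X : Polynomial ℂ) ^ (k - 1 - i) • a) ⊗ₜ[ℂ]
        ((Polynomial.X : Polynomial ℂ) ^ i • constP n (z k))) =
          (v ^ i * u ^ (k - 1 - i) * (v - u)) • (ev n u a ⊗ₜ[ℂ] z k) := fun k i ↦ by
      rw [evTwo_tmul, ev_smul, ev_smul, ev_constP, Polynomial.eval_pow, Polynomial.eval_pow,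
        Polynomial.eval_X, Polynomial.eval_X, TensorProduct.smul_tmul_smul, smul_smul]
      congr 1
      ring
    simp only [map_sum, Finset.smul_sum, h1, TensorProduct.tmul_sum]
    rw [← Finset.sum_add_distrib]
    refine Finset.sum_congr rfl fun k _ ↦ ?_
    rw [← Finset.sum_smul, ← Finset.sum_mul, geom_sum₂_mul, evTwo_tmul, evTwo_tmul, ev_smul,
      ev_smul, ev_constP, ev_constP, Polynomial.eval_pow, Polynomial.eval_pow, Polynomial.eval_X,
      Polynomial.eval_X, TensorProduct.tmul_smul, TensorProduct.tmul_smul, ← add_smul,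
      sub_add_cancel]

/-- The adjoint action of `SL(n, ℂ[u])` on `𝔤[u]`. -/
def adPoly (σ : Matrix.SpecialLinearGroup (Fin n) (Polynomial ℂ)) : P n →ₗ[ℂ] P n where
  toFun x := ⟨σ.1 * x.1 * (σ⁻¹).1, by
    have hx : Matrix.trace x.1 = 0 := x.2
    change Matrix.trace (σ.1 * x.1 * (σ⁻¹).1) = 0
    rw [Matrix.trace_mul_comm, ← Matrix.mul_assoc, specialLinear_inv_mul, Matrix.one_mul, hx]⟩
  map_add' x y := Subtype.ext (by
    change σ.1 * (x.1 + y.1) * (σ⁻¹).1 = σ.1 * x.1 * (σ⁻¹).1 + σ.1 * y.1 * (σ⁻¹).1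
    rw [Matrix.mul_add, Matrix.add_mul])
  map_smul' c x := Subtype.ext (by
    change σ.1 * (c • x.1) * (σ⁻¹).1 = c • (σ.1 * x.1 * (σ⁻¹).1)
    rw [Matrix.mul_smul, Matrix.smul_mul])

theorem adPoly_val (σ : Matrix.SpecialLinearGroup (Fin n) (Polynomial ℂ)) (x : P n) :
    (adPoly σ x).1 = σ.1 * x.1 * (σ⁻¹).1 := rfl

theorem ev_adPoly (c : ℂ) (σ : Matrix.SpecialLinearGroup (Fin n) (Polynomial ℂ)) (x : P n) :
    ev n c (adPoly σ x) = Ad (evGroup c σ) (ev n c x) := by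
  refine Subtype.ext ?_
  have h : ∀ a : P n, (ev n c a).1 = a.1.map (Polynomial.evalRingHom c) := fun a ↦
    Matrix.ext fun i j ↦ ev_apply c a i j
  rw [Ad_val, h, h, adPoly_val, Matrix.map_mul, Matrix.map_mul, evGroup, ← map_inv]
  rfl

theorem evTwo_map_adPoly (σ : Matrix.SpecialLinearGroup (Fin n) (Polynomial ℂ)) (u v : ℂ)
    (p : P n ⊗[ℂ] P n) : evTwo u v (TensorProduct.map (adPoly σ) (adPoly σ) p) =
      TensorProduct.map (Ad (evGroup u σ)) (Ad (evGroup v σ)) (evTwo u v p) := by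
  induction p with
  | zero => simp
  | tmul a b => simp [ev_adPoly]
  | add s t hs ht => simp only [map_add, hs, ht]

/-- On the diagonal u = v, Ad σ(u) ⊗ Ad σ(v) fixes Ω. Off the diagonal it changes Ω by a multiple (v
- u) s, which cancels the denominator and adds the polynomial u v s. -/
theorem exists_rFun_eq_map_Ad (σ : Matrix.SpecialLinearGroup (Fin n) (Polynomial ℂ))
    (p : P n ⊗[ℂ] P n) : ∃ p' : P n ⊗[ℂ] P n, ∀ u v : ℂ, u ≠ v → rFun p' u v =
      TensorProduct.map (Ad (evGroup u σ)) (Ad (evGroup v σ)) (rFun p u v) := by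
  let ω : P n ⊗[ℂ] P n := TensorProduct.map (constP n) (constP n) (Ω n)
  have hω : ∀ u v, evTwo u v ω = Ω n := fun u v ↦ by
    have : ∀ t : 𝔤 n ⊗[ℂ] 𝔤 n,
        evTwo u v (TensorProduct.map (constP n) (constP n) t) = t := fun t ↦ by
      induction t with
      | zero => simp
      | tmul a b => simp [ev_constP]
      | add s t hs ht => simp only [map_add, hs, ht]
    exact this _
  obtain ⟨s, hs⟩ := exists_evTwo_eq (TensorProduct.map (adPoly σ) (adPoly σ) ω)
  have hs' : ∀ u v, TensorProduct.map (Ad (evGroup u σ)) (Ad (evGroup v σ)) (Ω n) =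
      (v - u) • evTwo u v s + Ω n := fun u v ↦ by
    have := hs u v
    rwa [evTwo_map_adPoly, evTwo_map_adPoly, hω, hω, map_Ad_Ω] at this
  let X : P n →ₗ[ℂ] P n :=
    (LinearMap.lsmul (Polynomial ℂ) (P n) Polynomial.X).restrictScalars ℂ
  have hX : ∀ u v (t : P n ⊗[ℂ] P n), evTwo u v (TensorProduct.map X X t) =
      (u * v) • evTwo u v t := fun u v t ↦ by
    have hXa : ∀ c a, ev n c (X a) = c • ev n c a := fun c a ↦ by
      change ev n c ((Polynomial.X : Polynomial ℂ) • a) = _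
      rw [ev_smul, Polynomial.eval_X]
    induction t with
    | zero => simp
    | tmul a b =>
      rw [TensorProduct.map_tmul, evTwo_tmul, evTwo_tmul, hXa, hXa, TensorProduct.smul_tmul_smul]
    | add s t hs ht => simp only [map_add, hs, ht, smul_add]
  refine ⟨TensorProduct.map X X s + TensorProduct.map (adPoly σ) (adPoly σ) p, fun u v huv ↦ ?_⟩
  have h0 : v - u ≠ 0 := sub_ne_zero.2 huv.symm
  rw [rFun_eq, rFun_eq, map_add, map_add, map_smul, hX, evTwo_map_adPoly, hs', smul_add, smul_smul,
    div_mul_cancel₀ _ h0]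
  abel

/-! ### Gauge transformations and the conclusion -/

theorem br₁₂₁₃_map {A : 𝔤 n →ₗ[ℂ] 𝔤 n} (hA : ∀ x y, A ⁅x, y⁆ = ⁅A x, A y⁆)
    (B C : 𝔤 n →ₗ[ℂ] 𝔤 n) (x y : 𝔤 n ⊗[ℂ] 𝔤 n) :
    br₁₂₁₃ (TensorProduct.map A B x) (TensorProduct.map A C y) =
      TensorProduct.map A (TensorProduct.map B C) (br₁₂₁₃ x y) := by
  have hx : ∀ x x' y : 𝔤 n ⊗[ℂ] 𝔤 n, br₁₂₁₃ (x + x') y = br₁₂₁₃ x y + br₁₂₁₃ x' y :=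
    fun x x' y ↦ by simp [br₁₂₁₃]
  have hy : ∀ x y y' : 𝔤 n ⊗[ℂ] 𝔤 n, br₁₂₁₃ x (y + y') = br₁₂₁₃ x y + br₁₂₁₃ x y' :=
    fun x y y' ↦ by simp [br₁₂₁₃]
  induction x with
  | zero => simp [br₁₂₁₃]
  | add x x' h h' => rw [map_add, hx, h, h', hx, map_add]
  | tmul a b =>
    induction y with
    | zero => simp [br₁₂₁₃]
    | add y y' h h' => rw [map_add, hy, h, h', hy, map_add]
    | tmul c d => simp [br₁₂₁₃_tmul, hA]

theorem br₁₂₂₃_map {B : 𝔤 n →ₗ[ℂ] 𝔤 n} (hB : ∀ x y, B ⁅x, y⁆ = ⁅B x, B y⁆)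
    (A C : 𝔤 n →ₗ[ℂ] 𝔤 n) (x y : 𝔤 n ⊗[ℂ] 𝔤 n) :
    br₁₂₂₃ (TensorProduct.map A B x) (TensorProduct.map B C y) =
      TensorProduct.map A (TensorProduct.map B C) (br₁₂₂₃ x y) := by
  have hx : ∀ x x' y : 𝔤 n ⊗[ℂ] 𝔤 n, br₁₂₂₃ (x + x') y = br₁₂₂₃ x y + br₁₂₂₃ x' y :=
    fun x x' y ↦ by simp [br₁₂₂₃]
  have hy : ∀ x y y' : 𝔤 n ⊗[ℂ] 𝔤 n, br₁₂₂₃ x (y + y') = br₁₂₂₃ x y + br₁₂₂₃ x y' :=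
    fun x y y' ↦ by simp [br₁₂₂₃]
  induction x with
  | zero => simp [br₁₂₂₃]
  | add x x' h h' => rw [map_add, hx, h, h', hx, map_add]
  | tmul a b =>
    induction y with
    | zero => simp [br₁₂₂₃]
    | add y y' h h' => rw [map_add, hy, h, h', hy, map_add]
    | tmul c d => simp [br₁₂₂₃_tmul, hB]

theorem br₁₃₂₃_map {C : 𝔤 n →ₗ[ℂ] 𝔤 n} (hC : ∀ x y, C ⁅x, y⁆ = ⁅C x, C y⁆)
    (A B : 𝔤 n →ₗ[ℂ] 𝔤 n) (x y : 𝔤 n ⊗[ℂ] 𝔤 n) :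
    br₁₃₂₃ (TensorProduct.map A C x) (TensorProduct.map B C y) =
      TensorProduct.map A (TensorProduct.map B C) (br₁₃₂₃ x y) := by
  have hx : ∀ x x' y : 𝔤 n ⊗[ℂ] 𝔤 n, br₁₃₂₃ (x + x') y = br₁₃₂₃ x y + br₁₃₂₃ x' y :=
    fun x x' y ↦ by simp [br₁₃₂₃]
  have hy : ∀ x y y' : 𝔤 n ⊗[ℂ] 𝔤 n, br₁₃₂₃ x (y + y') = br₁₃₂₃ x y + br₁₃₂₃ x y' :=
    fun x y y' ↦ by simp [br₁₃₂₃]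
  induction x with
  | zero => simp [br₁₃₂₃]
  | add x x' h h' => rw [map_add, hx, h, h', hx, map_add]
  | tmul a b =>
    induction y with
    | zero => simp [br₁₃₂₃]
    | add y y' h h' => rw [map_add, hy, h, h', hy, map_add]
    | tmul c d => simp [br₁₃₂₃_tmul, hC]

/-- Gauge transformations preserve quasi-rational `r`-matrices. -/
theorem exists_gauge_transform (q : QuasiRationalRMatrix n)
    (σ : Matrix.SpecialLinearGroup (Fin n) (Polynomial ℂ)) :
    ∃ q' : QuasiRationalRMatrix n, ∀ u v : ℂ, u ≠ v → q'.eval u v =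
      TensorProduct.map (Ad (evGroup u σ)) (Ad (evGroup v σ)) (q.eval u v) := by
  obtain ⟨p', hp'⟩ := exists_rFun_eq_map_Ad σ q.poly
  have hq : ∀ u v, TensorProduct.comm ℂ (𝔤 n) (𝔤 n) (rFun q.poly u v) = -rFun q.poly v u := by
    intro u v
    have h : u * v / (v - u) = -(v * u / (u - v)) := by
      rw [← neg_sub u v, div_neg, mul_comm]
    rw [rFun_eq, rFun_eq, map_add, map_smul, comm_Ω, comm_evTwo, q.skew, map_neg, h, neg_smul,
      neg_add]
  have hskew : ∀ u v, u ≠ v →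
      TensorProduct.comm ℂ (𝔤 n) (𝔤 n) (evTwo u v p') = -evTwo v u p' := by
    intro u v huv
    have h1 := congrArg (TensorProduct.comm ℂ (𝔤 n) (𝔤 n)) (hp' u v huv)
    have h : u * v / (v - u) = -(v * u / (u - v)) := by
      rw [← neg_sub u v, div_neg, mul_comm]
    rw [comm_map, hq, map_neg, ← hp' v u huv.symm, rFun_eq, rFun_eq, map_add, map_smul, comm_Ω, h,
      neg_add, neg_smul] at h1
    exact add_left_cancel h1
  -- Skewness of p' is known only for its values at u ≠ v. Antisymmetrizing makes the tensor itself
  -- skew without changing these values.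
  set p : P n ⊗[ℂ] P n := (1 / 2 : ℂ) • (p' - TensorProduct.comm ℂ (P n) (P n) p') with hpdef
  have hpe : ∀ u v, u ≠ v → rFun p u v = rFun p' u v := by
    intro u v huv
    rw [rFun_eq, rFun_eq, hpdef, map_smul, map_sub, ← comm_evTwo, hskew v u huv.symm,
      sub_neg_eq_add, ← two_smul ℂ (evTwo u v p'), smul_smul]
    norm_num
  refine ⟨⟨p, ?_, ?_⟩, fun u v huv ↦ (hpe u v huv).trans (hp' u v huv)⟩
  · have h2 : ∀ t : P n ⊗[ℂ] P n,
        TensorProduct.comm ℂ (P n) (P n) (TensorProduct.comm ℂ (P n) (P n) t) = t := fun t ↦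
      (TensorProduct.comm ℂ (P n) (P n)).left_inv t
    rw [hpdef, map_smul, map_sub, h2, ← smul_neg, neg_sub]
  · intro u₁ u₂ u₃ h12 h13 h23
    rw [hpe _ _ h12, hpe _ _ h13, hpe _ _ h23, hp' _ _ h12, hp' _ _ h13, hp' _ _ h23,
      br₁₂₁₃_map (Ad_lie _), br₁₂₂₃_map (Ad_lie _), br₁₃₂₃_map (Ad_lie _), ← map_add, ← map_add,
      q.cybe u₁ u₂ u₃ h12 h13 h23, map_zero]

/-- The test elements of gauge equivalent `r`-matrices are conjugate. -/
theorem graphMap_testElt_gauge {p p' : P n ⊗[ℂ] P n}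
    {σ : Matrix.SpecialLinearGroup (Fin n) (Polynomial ℂ)}
    (h : ∀ u v : ℂ, u ≠ v → rFun p' u v =
      TensorProduct.map (Ad (evGroup u σ)) (Ad (evGroup v σ)) (rFun p u v)) (c : ℂ) (z : 𝔤 n) :
    (graphMap p' (testElt c z)).1.1 = σ.1.map ofPoly *
      (graphMap p (testElt c (Ad (evGroup c σ)⁻¹ z))).1.1 * (σ⁻¹).1.map ofPoly := by
  have hnum : numer p' c z = adPoly σ (numer p c (Ad (evGroup c σ)⁻¹ z)) := by
    rw [← sub_eq_zero]
    refine eq_zero_of_ev_eq_zero {c} fun u hu ↦ ?_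
    have hcu : c ≠ u := fun h ↦ hu (by simp [h])
    rw [map_sub, ev_adPoly, ev_numer _ hcu, ev_numer _ hcu, h c u hcu, contractFst_map_Ad,
      map_smul, sub_self]
  -- In the field of Laurent series u - c can be cancelled for every c, including zero. Only the
  -- first component is compared for this reason.
  set s := ofPoly (Polynomial.X - Polynomial.C c)
  have hs : s ≠ 0 := fun h ↦
    Polynomial.X_sub_C_ne_zero c (ofPoly_injective (by rw [map_zero]; exact h))
  have h1 : ∀ (p : P n ⊗[ℂ] P n) z, s • (graphMap p (testElt c z)).1.1 =
      (numer p c z).1.map ofPoly := fun p z ↦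
    congrArg (fun x : Double n ↦ x.1.1) (act_graphMap_testElt p c z)
  have h2 := h1 p' z
  rw [hnum, adPoly_val, Matrix.map_mul, Matrix.map_mul, ← h1, Matrix.mul_smul, Matrix.smul_mul]
    at h2
  exact smul_right_injective _ hs h2

/-- Every quasi-rational `r`-matrix is gauge equivalent to one whose Lagrangian subalgebra lies in
some `W_k`. -/
theorem exists_gaugeEquivalent_subset_Wk {n : ℕ} (hn : 2 ≤ n) (q₁ : QuasiRationalRMatrix n) :
    ∃ q₂ : QuasiRationalRMatrix n, GaugeEquivalent q₁ q₂ ∧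
      ∃ W₂ : LieSubalgebra ℂ (Double n),
        IsLagrangian W₂ ∧ Corresponds W₂ q₂ ∧
          ∃ k : ℕ, k ≤ n ∧ (W₂ : Set (Double n)) ⊆ Wk n k := by
  obtain ⟨M, hM⟩ := exists_graphSub_mem_bd q₁.poly
  obtain ⟨N, hN⟩ := exists_contract_eq_zero q₁.poly
  obtain ⟨σ, k, hk, hσ⟩ := exists_conj_mem_bd hn
    ((fun x : Double n ↦ x.1.1) '' (graphSub q₁.poly : Set (Double n))) M N
    (by
      rintro _ ⟨x, hx, rfl⟩ _ ⟨y, hy, rfl⟩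
      exact ⟨⁅x, y⁆, lie_mem_graphSub q₁.skew q₁.cybe hx hy, rfl⟩)
    (by
      rintro _ ⟨x, hx, rfl⟩
      exact x.1.2)
    (by
      rintro _ ⟨x, hx, rfl⟩
      exact hM x hx)
    (fun x hx hxN ↦ by
      refine ⟨(⟨x, hx⟩, 0), ⟨(⟨x, hx⟩, 0), ?_, graphMap_eq_self (hN _ rfl hxN)⟩, rfl⟩
      exact mem_pStar_of_mem_bd rfl fun i j ↦ bd_mono (by omega) (hxN i j))
    (fun f hf ↦ by
      obtain ⟨y, hy, a, hya⟩ := exists_graphSub_add_emb q₁.poly ((⟨f, hf⟩, 0) : Double n)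
      exact ⟨_, ⟨y, hy, rfl⟩, a.1, congrArg (fun x : Double n ↦ x.1.1) hya⟩)
  -- The inverse is used because the order contains σ⁻¹ x σ.
  obtain ⟨q₂, hq₂⟩ := exists_gauge_transform q₁ σ⁻¹
  refine ⟨q₂, ⟨σ⁻¹, hq₂⟩, correspondingSubalgebra q₂, isLagrangian_correspondingSubalgebra q₂,
    corresponds_correspondingSubalgebra q₂, k, hk, ?_⟩
  rintro _ ⟨w, hw, rfl⟩
  refine mem_Wk _ fun i j ↦ ?_
  obtain ⟨N', hN'⟩ := exists_contract_eq_zero q₂.poly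
  -- The bound N' + 1 rather than N' puts the remainder in degree at most -1, which the order allows
  -- in every entry.
  obtain ⟨z, r, hr2, hr1, rfl⟩ := exists_sum_testElt_add hw (N' + 1)
    (fun i ↦ ((i : ℕ) : ℂ)) (fun i j h ↦ by simpa [Fin.ext_iff] using h)
  have hr : graphMap q₂.poly r = r := graphMap_eq_self
    (hN' r hr2 fun i j ↦ bd_mono (by push_cast; omega) (hr1 i j))
  rw [map_add, hr, map_sum, Prod.fst_add, Prod.fst_sum, AddMemClass.coe_add, Matrix.add_apply,
    AddSubmonoidClass.coe_finsetSum, Matrix.sum_apply]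
  refine add_mem (sum_mem fun l _ ↦ ?_) (bd_mono ?_ (hr1 i j))
  · rw [graphMap_testElt_gauge hq₂, inv_inv]
    exact hσ _ ⟨_, ⟨_, testElt_mem_pStar _ _, rfl⟩, rfl⟩ i j
  · push_cast
    split_ifs <;> omega

end QuasiRational

end

theorem theorem3 (n : ℕ) (hn : 2 ≤ n) (q₁ : QuasiRationalRMatrix n) :
    ∃ q₂ : QuasiRationalRMatrix n, QuasiRational.GaugeEquivalent q₁ q₂ ∧
      ∃ W₂ : LieSubalgebra ℂ (QuasiRational.Double n),
        QuasiRational.IsLagrangian W₂ ∧ QuasiRational.Corresponds W₂ q₂ ∧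
          ∃ k : ℕ, k ≤ n ∧ (W₂ : Set (QuasiRational.Double n)) ⊆ QuasiRational.Wk n k :=
  QuasiRational.exists_gaugeEquivalent_subset_Wk hn q₁
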